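/- **Theorem.** The maximal induced sub-cographs of a graph can be enumerated with polynomial delay, using exponential space. In detail: a *cograph* is a graph that can be built from one-vertex graphs by disjoint union and complementation. For a finite simple graph $G$ on $\{0,\dots,n-1\}$, a vertex set $S$ is a *maximal induced sub-cograph* if $G[S]$ is a cograph and $G[T]$ is not a cograph for any $T\supsetneq S$. There are one deterministic random-access-machine program $P$ and polynomials $p,q$ such that for every $n$ and every graph $G$ on $\{0,\dots,n-1\}$, given by $n$ and its adjacency matrix, the program $P$ halts and outputs every maximal induced sub-cograph of $G$ exactly once and nothing else (each set $S$ being output as its characteristic bit vector, that is, as the binary number $\sum_{v\in S}2^v$), in such a way that * the time up to the first output, the time between any two consecutive outputs, and the time from the last output to the end are each at most $p(n)$ (if there is no output, the total time is at most $p(n)$); * at every moment of the computation the memory occupies at most $2^{q(n)}$ bits. Here the machine is a random access machine whose cells, initially $0$ outside the input, hold natural numbers, with the operations $+$, truncated $-$, $\times$, integer division, remainder, comparison, reading and writing at computed addresses, branching, loops and output. Time is logarithmic cost: each elementary operation costs one plus the binary lengths of the numbers (constants, addresses, contents, results) it handles. The memory in use is the sum, over the cells in use, of one plus the binary lengths of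 the address and of the content. -/

import Mathlib

universe u

/-! ### Cographs -/

/-- Cographs: the graphs obtained from one-vertex graphs by disjoint union and complement
(up to isomorphism). -/
inductive IsCograph : {V : Type u} → SimpleGraph V → Prop
  | single {V : Type u} [Unique V] (G : SimpleGraph V) : IsCograph G
  | sum {V W : Type u} {G : SimpleGraph V} {H : SimpleGraph W} :
      IsCograph G → IsCograph H → IsCograph (G.sum H)
  | compl {V : Type u} {G : SimpleGraph V} : IsCograph G → IsCograph Gᶜ
  | iso {V W : Type u} {G : SimpleGraph V} {H : SimpleGraph W} :
      (G ≃g H) → IsCograph G → IsCograph H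

/-- The vertex set `S` induces a sub-cograph of `G` and is inclusion-wise maximal with this
property. -/
def IsMaximalInducedCograph {V : Type u} (G : SimpleGraph V) (S : Finset V) : Prop :=
  Maximal (fun T : Finset V => IsCograph (G.induce (T : Set V))) S

/-! ### A random access machine with logarithmic cost

Programs are while-programs over a memory made of banks (arrays) of cells holding natural
numbers. A program mentions finitely many banks by name; a cell inside a bank is addressed by a
computed address. Handling a number costs its binary length. -/

namespace RAM

/-- `m a i` is the content of the cell with address `i` in the bank `a`. -/
abbrev Memory : Type := ℕ → ℕ → ℕ

/-- The binary arithmetic operations and comparisons. -/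
inductive Op : Type
  | add | sub | mul | div | mod | eq | lt

/-- Subtraction is truncated at `0`; comparisons return `0` or `1`. -/
def Op.apply : Op → ℕ → ℕ → ℕ
  | .add, x, y => x + y
  | .sub, x, y => x - y
  | .mul, x, y => x * y
  | .div, x, y => x / y
  | .mod, x, y => x % y
  | .eq, x, y => if x = y then 1 else 0
  | .lt, x, y => if x < y then 1 else 0

inductive Expr : Type
  | const (c : ℕ) : Expr
  | load (bank : ℕ) (addr : Expr) : Expr
  | op (o : Op) (e₁ e₂ : Expr) : Expr

def Expr.eval (m : Memory) : Expr → ℕ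
  | .const c => c
  | .load a e => m a (e.eval m)
  | .op o e₁ e₂ => o.apply (e₁.eval m) (e₂.eval m)

/-- Every number that occurs in the evaluation (constants, addresses, loaded values, results of
operations) costs one plus its binary length. -/
def Expr.cost (m : Memory) : Expr → ℕ
  | .const c => 1 + Nat.size c
  | .load a e => e.cost m + 1 + Nat.size (m a (e.eval m))
  | .op o e₁ e₂ =>
      e₁.cost m + e₂.cost m + 1 + Nat.size (o.apply (e₁.eval m) (e₂.eval m))

inductive Program : Type
  | skip : Program
  /-- write the value of `e` into the cell of the bank `bank` with address `addr` -/
  | store (bank : ℕ) (addr e : Expr) : Program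
  /-- output the value of `e` -/
  | output (e : Expr) : Program
  | seq (P Q : Program) : Program
  | cond (e : Expr) (P Q : Program) : Program
  /-- repeat `P` as long as the value of `e` is not `0` -/
  | loop (e : Expr) (P : Program) : Program

/-- Writing the value `x` into one cell. -/
def Memory.write (m : Memory) (a i x : ℕ) : Memory :=
  fun b j => if b = a ∧ j = i then x else m b j

/-- What is recorded about one elementary step of a computation. -/
structure Step where
  /-- the cost of the step -/
  cost : ℕ
  /-- the number that is output by the step, if any -/
  out : Option ℕ
  /-- the memory after the step -/
  mem : Memory

/-- `Exec P m t m'`: the program `P`, started with the memory `m`, halts with the memory `m'`,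
and `t` is the list of the elementary steps of this computation. -/
inductive Exec : Program → Memory → List Step → Memory → Prop
  | skip (m : Memory) : Exec .skip m [] m
  | store (a : ℕ) (i e : Expr) (m : Memory) :
      Exec (.store a i e) m
        [⟨1 + i.cost m + e.cost m, none, m.write a (i.eval m) (e.eval m)⟩]
        (m.write a (i.eval m) (e.eval m))
  | output (e : Expr) (m : Memory) :
      Exec (.output e) m [⟨1 + e.cost m, some (e.eval m), m⟩] m
  | seq {P Q : Program} {m₁ m₂ m₃ : Memory} {t₁ t₂ : List Step} :
      Exec P m₁ t₁ m₂ → Exec Q m₂ t₂ m₃ → Exec (.seq P Q) m₁ (t₁ ++ t₂) m₃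
  | cond_true {e : Expr} {P Q : Program} {m m' : Memory} {t : List Step} :
      e.eval m ≠ 0 → Exec P m t m' → Exec (.cond e P Q) m (⟨1 + e.cost m, none, m⟩ :: t) m'
  | cond_false {e : Expr} {P Q : Program} {m m' : Memory} {t : List Step} :
      e.eval m = 0 → Exec Q m t m' → Exec (.cond e P Q) m (⟨1 + e.cost m, none, m⟩ :: t) m'
  | loop_true {e : Expr} {P : Program} {m₁ m₂ m₃ : Memory} {t₁ t₂ : List Step} :
      e.eval m₁ ≠ 0 → Exec P m₁ t₁ m₂ → Exec (.loop e P) m₂ t₂ m₃ →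
        Exec (.loop e P) m₁ (⟨1 + e.cost m₁, none, m₁⟩ :: (t₁ ++ t₂)) m₃
  | loop_false {e : Expr} {P : Program} {m : Memory} :
      e.eval m = 0 → Exec (.loop e P) m [⟨1 + e.cost m, none, m⟩] m

/-- The numbers that are output, in chronological order. -/
def outputs (t : List Step) : List ℕ := t.filterMap Step.out

/-- Auxiliary function for `delays`; `acc` is the cost since the last output. -/
def delaysFrom : ℕ → List Step → List ℕ
  | acc, [] => [acc]
  | acc, s :: t =>
      if s.out.isSome then (acc + s.cost) :: delaysFrom 0 t else delaysFrom (acc + s.cost) t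

/-- The delays of a computation: the time up to (and including) the first output, the times
between consecutive outputs, and the time from the last output to the end. -/
def delays (t : List Step) : List ℕ := delaysFrom 0 t

/-- The memory `m` occupies at most `N` bits: the binary lengths of the addresses and of the
contents of the cells in use (all cells outside the finite set `C` are empty) sum up to at most
`N`, one extra bit being charged for each cell. -/
def SpaceAtMost (m : Memory) (N : ℕ) : Prop :=
  ∃ C : Finset (ℕ × ℕ), (∀ a i, m a i ≠ 0 → (a, i) ∈ C) ∧
    ∑ c ∈ C, (1 + Nat.size c.2 + Nat.size (m c.1 c.2)) ≤ N

open Classical in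
/-- The initial memory for the input graph `G` on the vertices `0, …, n - 1`: the number `n` in
the cell `0` of bank `0`, the adjacency matrix, row by row, in bank `1`, and `0` elsewhere. -/
noncomputable def graphInput {n : ℕ} (G : SimpleGraph (Fin n)) : Memory := fun a i =>
  if a = 0 ∧ i = 0 then n
  else if a = 1 ∧ ∃ u v : Fin n, i = (u : ℕ) * n + v ∧ G.Adj u v then 1
  else 0

/-- The number whose binary digits form the characteristic vector of `S`. -/
def setCode {n : ℕ} (S : Finset (Fin n)) : ℕ := ∑ v ∈ S, 2 ^ (v : ℕ)

end RAM

/-!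
A nonempty vertex set of a finite graph induces a cograph if and only if it contains no induced path
on four vertices (`isCograph_induce_iff`), because a `P4`-free set with at least two vertices is
disconnected in the graph or in its complement (`P4Free.exists_isCut`). By the same fact every
`P4`-free set with at least two vertices has twins (`P4Free.exists_twins`), and conversely adding a
twin of a vertex to a `P4`-free set keeps it `P4`-free (`P4Free.insert_twin`).

The enumeration is a breadth-first search in a graph on the set of all solutions. A solution `S` has
one neighbour for each pair `u`, `v` of vertices: add `v` to `S`, delete the vertices that
distinguish `u` from `v` so that `v` becomes a twin of `u`, and extend the result greedily to a
maximal `P4`-free set. Every nonempty family of solutions that is closed under taking neighbours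
contains all solutions. Indeed every nonempty `P4`-free set `P` lies below a member
(`P4Free.exists_superset`): let `v` be a twin of `u` in `P`; by induction `P \ {v}` lies below a
member `S`, and passing to the neighbour of `S` for `u`, `v` deletes no vertex of `P`.

Each solution has only `n ^ 2` neighbours, and each of them is computed in polynomial time. Known
solutions are marked in a bank that is addressed by the codes of sets, so a lookup takes one step of
polynomial cost, and exponential space suffices. A solution is output when it is taken from the
queue, hence at most one exploration lies between two outputs (`RAM.exec_search`).

The cost is bounded in two stages. As long as all addresses and contents of the memory are smaller
than `2 ^ (4 * n + 4)`, every step of a fixed program has cost linear in `n` and the memory occupies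
at most exponentially many bits (`RAM.Exec.cost_le`, `RAM.Bounded.spaceAtMost`); so the verification
of the program only has to count steps and to bound the numbers that are stored.
-/

/-! ### Cographs and induced paths on four vertices -/

/-- `a`, `b`, `c`, `d` are, in this order, the vertices of an induced path of `G`. The four
vertices are automatically distinct. -/
def InducedP4 {V : Type*} (G : SimpleGraph V) (a b c d : V) : Prop :=
  G.Adj a b ∧ G.Adj b c ∧ G.Adj c d ∧ ¬ G.Adj a c ∧ ¬ G.Adj a d ∧ ¬ G.Adj b d

/-- No induced path on four vertices of `G` lies in `X`. -/
def P4Free {V : Type*} (G : SimpleGraph V) (X : Finset V) : Prop :=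
  ∀ a ∈ X, ∀ b ∈ X, ∀ c ∈ X, ∀ d ∈ X, ¬ InducedP4 G a b c d

theorem InducedP4.compl {V : Type*} {G : SimpleGraph V} {a b c d : V}
    (h : InducedP4 Gᶜ a b c d) : InducedP4 G b d a c := by
  obtain ⟨h1, h2, h3, h4, h5, h6⟩ := h
  simp only [SimpleGraph.compl_adj, not_and, not_not, ne_eq] at h1 h2 h3 h4 h5 h6
  have hac : a ≠ c := by
    rintro rfl
    exact h3.2 (h5 (by rintro rfl; exact h3.1 rfl))
  have had : a ≠ d := by
    rintro rfl
    exact h3.2 (h4 hac).symm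
  have hbd : b ≠ d := by
    rintro rfl
    exact h1.2 (h5 h1.1)
  have hac' := h4 hac
  have had' := h5 had
  have hbd' := h6 hbd
  exact ⟨hbd', had'.symm, hac', fun h => h1.2 h.symm, h2.2, fun h => h3.2 h.symm⟩

theorem P4Free.subset {V : Type*} {G : SimpleGraph V} {X Y : Finset V}
    (hY : P4Free G Y) (h : X ⊆ Y) : P4Free G X :=
  fun a ha b hb c hc d hd => hY a (h ha) b (h hb) c (h hc) d (h hd)

theorem P4Free.compl {V : Type*} {G : SimpleGraph V} {X : Finset V}
    (hX : P4Free G X) : P4Free Gᶜ X :=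
  fun a ha b hb c hc d hd h => hX b hb d hd a ha c hc h.compl

theorem P4Free.singleton {V : Type*} (G : SimpleGraph V) (v : V) : P4Free G {v} := by
  intro a ha b hb c _ d _ h
  rw [Finset.mem_singleton] at ha hb
  subst ha hb
  exact G.loopless.irrefl _ h.1

/-- The disjoint nonempty sets `A` and `B` with union `X` have no edge between them. -/
def IsCut {V : Type*} (G : SimpleGraph V) (X A B : Finset V) : Prop :=
  A.Nonempty ∧ B.Nonempty ∧ (∀ x, x ∈ X ↔ x ∈ A ∨ x ∈ B) ∧ (∀ x ∈ A, x ∉ B) ∧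
    ∀ a ∈ A, ∀ b ∈ B, ¬ G.Adj a b

/-- Adding a vertex `v` to a `P4`-free set that is disconnected keeps the set disconnected, in
`G` or in its complement: otherwise `v` has a neighbour `z` on one side of the cut and
distinguishes the ends of an edge `x y` on the other side, and `z v x y` is an induced path. -/
theorem IsCut.exists_insert {V : Type*} [DecidableEq V] {G : SimpleGraph V} {X A B : Finset V}
    {v : V} (h : IsCut G X A B) (hv : v ∉ X) (hX : P4Free G (insert v X)) :
    ∃ A' B', IsCut G (insert v X) A' B' ∨ IsCut Gᶜ (insert v X) A' B' := by
  classical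
  -- the case where some vertex of `A` is not adjacent to `v`
  have key : ∀ A B : Finset V, IsCut G X A B → (∃ y ∈ A, ¬ G.Adj v y) →
      ∃ A' B', IsCut G (insert v X) A' B' := by
    rintro A B ⟨hA, hB, hAB, hd, hno⟩ ⟨y, hy, hvy⟩
    by_cases hz : ∃ z ∈ B, G.Adj v z
    · obtain ⟨z, hz, hvz⟩ := hz
      refine ⟨A.filter (fun y => ¬ G.Adj v y), insert v (B ∪ A.filter (fun y => G.Adj v y)),
        ⟨y, by simp [hy, hvy]⟩, ⟨v, by simp⟩, ?_, ?_, ?_⟩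
      · intro x
        simp only [Finset.mem_insert, Finset.mem_union, Finset.mem_filter, hAB]
        tauto
      · intro x hx
        simp only [Finset.mem_insert, Finset.mem_union, Finset.mem_filter, not_or] at hx ⊢
        refine ⟨?_, hd x hx.1, fun h => hx.2 h.2⟩
        rintro rfl
        exact hv ((hAB _).2 (Or.inl hx.1))
      · intro a ha b hb hab
        simp only [Finset.mem_insert, Finset.mem_union, Finset.mem_filter] at ha hb
        rcases hb with rfl | hb | hb
        · exact ha.2 hab.symm
        · exact hno a ha.1 b hb hab
        · refine hX z (by simp [hAB, hz]) v (by simp) b (by simp [hAB, hb.1]) a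
            (by simp [hAB, ha.1]) ⟨hvz.symm, hb.2, hab.symm, ?_, ?_, ha.2⟩
          · exact fun h => hno b hb.1 z hz h.symm
          · exact fun h => hno a ha.1 z hz h.symm
    · push Not at hz
      refine ⟨insert v A, B, ⟨v, by simp⟩, hB, ?_, ?_, ?_⟩
      · intro x
        simp only [Finset.mem_insert, hAB]
        tauto
      · intro x hx hxB
        rcases Finset.mem_insert.1 hx with rfl | hx
        · exact hv ((hAB _).2 (Or.inr hxB))
        · exact hd x hx hxB
      · intro a ha b hb
        rcases Finset.mem_insert.1 ha with rfl | ha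
        · exact hz b hb
        · exact hno a ha b hb
  have h' : IsCut G X B A :=
    ⟨h.2.1, h.1, fun x => (h.2.2.1 x).trans or_comm, fun x hx hxA => h.2.2.2.1 x hxA hx,
      fun a ha b hb hab => h.2.2.2.2 b hb a ha hab.symm⟩
  by_cases h1 : ∃ y ∈ A, ¬ G.Adj v y
  · obtain ⟨A', B', hc⟩ := key A B h h1
    exact ⟨A', B', Or.inl hc⟩
  by_cases h2 : ∃ y ∈ B, ¬ G.Adj v y
  · obtain ⟨A', B', hc⟩ := key B A h' h2
    exact ⟨A', B', Or.inl hc⟩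
  push Not at h1 h2
  refine ⟨{v}, X, Or.inr ⟨by simp, ?_, by simp, ?_, ?_⟩⟩
  · obtain ⟨y, hy⟩ := h.1
    exact ⟨y, (h.2.2.1 y).2 (Or.inl hy)⟩
  · simpa using hv
  · intro a ha b hb hab
    rw [Finset.mem_singleton] at ha
    subst ha
    rcases (h.2.2.1 b).1 hb with hb | hb
    · exact hab.2 (h1 b hb)
    · exact hab.2 (h2 b hb)

/-- A `P4`-free set with at least two vertices is disconnected in the graph or in its
complement. -/
theorem P4Free.exists_isCut {V : Type*} {G : SimpleGraph V} {X : Finset V}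
    (hX : P4Free G X) (hcard : 2 ≤ X.card) :
    ∃ A B, IsCut G X A B ∨ IsCut Gᶜ X A B := by
  classical
  induction X using Finset.induction_on with
  | empty => simp at hcard
  | insert v X hv ih =>
    by_cases hX2 : 2 ≤ X.card
    · obtain ⟨A, B, h | h⟩ := ih (hX.subset (Finset.subset_insert v X)) hX2
      · exact h.exists_insert hv hX
      · obtain ⟨A', B', h⟩ := h.exists_insert hv hX.compl
        rw [compl_compl] at h
        exact ⟨A', B', h.symm⟩
    · rw [Finset.card_insert_of_notMem hv] at hcard
      obtain ⟨u, rfl⟩ := Finset.card_eq_one.1 (show X.card = 1 by omega)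
      have huv : v ≠ u := by simpa using hv
      by_cases h : G.Adj v u
      · exact ⟨{v}, {u}, Or.inr ⟨by simp, by simp, by simp, by simpa using huv,
          by simp [h]⟩⟩
      · exact ⟨{v}, {u}, Or.inl ⟨by simp, by simp, by simp, by simpa using huv,
          by simp [h]⟩⟩

theorem IsCut.subset_left {V : Type*} {G : SimpleGraph V} {X A B : Finset V}
    (h : IsCut G X A B) : A ⊆ X :=
  fun x hx => (h.2.2.1 x).2 (Or.inl hx)

theorem IsCut.subset_right {V : Type*} {G : SimpleGraph V} {X A B : Finset V}
    (h : IsCut G X A B) : B ⊆ X :=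
  fun x hx => (h.2.2.1 x).2 (Or.inr hx)

theorem IsCut.card_add {V : Type*} {G : SimpleGraph V} {X A B : Finset V}
    (h : IsCut G X A B) : A.card + B.card = X.card := by
  classical
  rw [← Finset.card_union_of_disjoint (Finset.disjoint_left.2 h.2.2.2.1)]
  congr 1
  ext x
  simp [h.2.2.1]

theorem IsCut.card_lt {V : Type*} {G : SimpleGraph V} {X A B : Finset V}
    (h : IsCut G X A B) : A.card < X.card ∧ B.card < X.card := by
  have h1 := h.1.card_pos
  have h2 := h.2.1.card_pos
  have h3 := h.card_add
  omega

/-- The two sides of a cut of `X` make `X` a disjoint union. -/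
theorem IsCut.isCograph {V : Type u} {G : SimpleGraph V} {X A B : Finset V}
    (h : IsCut G X A B) (hA : IsCograph (G.induce (A : Set V)))
    (hB : IsCograph (G.induce (B : Set V))) : IsCograph (G.induce (X : Set V)) := by
  obtain ⟨-, -, hX, hd, hno⟩ := h
  refine IsCograph.iso ⟨Equiv.ofBijective
    (Sum.elim (fun a => ⟨a.1, (hX _).2 (Or.inl a.2)⟩) (fun b => ⟨b.1, (hX _).2 (Or.inr b.2)⟩))
    ⟨?_, ?_⟩, ?_⟩ (IsCograph.sum hA hB)
  · rintro (⟨a, ha⟩ | ⟨a, ha⟩) (⟨b, hb⟩ | ⟨b, hb⟩) hab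
    · simpa using hab
    · simp only [Sum.elim_inl, Sum.elim_inr, Subtype.mk.injEq] at hab
      subst hab
      exact absurd hb (hd a ha)
    · simp only [Sum.elim_inl, Sum.elim_inr, Subtype.mk.injEq] at hab
      subst hab
      exact absurd ha (hd a hb)
    · simpa using hab
  · rintro ⟨x, hx⟩
    rcases (hX x).1 hx with h | h
    · exact ⟨Sum.inl ⟨x, h⟩, rfl⟩
    · exact ⟨Sum.inr ⟨x, h⟩, rfl⟩
  · rintro (⟨a, ha⟩ | ⟨a, ha⟩) (⟨b, hb⟩ | ⟨b, hb⟩)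
    · simp
    · simpa using hno a ha b hb
    · simpa using fun h => hno b hb a ha h.symm
    · simp

theorem isCograph_compl_induce {V : Type u} {G : SimpleGraph V} {X : Set V}
    (h : IsCograph (G.induce X)) : IsCograph (Gᶜ.induce X) := by
  refine IsCograph.iso ⟨Equiv.refl _, ?_⟩ (IsCograph.compl h)
  intro a b
  simp [SimpleGraph.compl_adj, Subtype.ext_iff]

theorem P4Free.isCograph {V : Type u} {G : SimpleGraph V} {X : Finset V}
    (hne : X.Nonempty) (hX : P4Free G X) : IsCograph (G.induce (X : Set V)) := by
  induction hn : X.card using Nat.strong_induction_on generalizing X with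
  | _ n ih =>
    by_cases hcard : 2 ≤ X.card
    · obtain ⟨A, B, h | h⟩ := hX.exists_isCut hcard
      · exact h.isCograph (ih _ (hn ▸ h.card_lt.1) h.1 (hX.subset h.subset_left) rfl)
          (ih _ (hn ▸ h.card_lt.2) h.2.1 (hX.subset h.subset_right) rfl)
      · have hc := h.isCograph
          (isCograph_compl_induce (ih _ (hn ▸ h.card_lt.1) h.1 (hX.subset h.subset_left) rfl))
          (isCograph_compl_induce (ih _ (hn ▸ h.card_lt.2) h.2.1 (hX.subset h.subset_right) rfl))
        simpa using isCograph_compl_induce hc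
    · have := hne.card_pos
      obtain ⟨v, rfl⟩ := Finset.card_eq_one.1 (show X.card = 1 by omega)
      have : Unique (({v} : Finset V) : Set V) :=
        ⟨⟨⟨v, by simp⟩⟩, fun x => Subtype.ext (by simpa using x.2)⟩
      exact IsCograph.single _

theorem IsCograph.nonempty {V : Type u} {G : SimpleGraph V} (h : IsCograph G) : Nonempty V := by
  induction h with
  | single G => exact ⟨default⟩
  | sum _ _ ih _ => exact ⟨Sum.inl ih.some⟩
  | compl _ ih => exact ih
  | iso e _ ih => exact ⟨e ih.some⟩

theorem IsCograph.not_inducedP4 {V : Type u} {G : SimpleGraph V} (h : IsCograph G) :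
    ∀ a b c d : V, ¬ InducedP4 G a b c d := by
  induction h with
  | single G =>
    intro a b c d h
    exact h.1.ne (Subsingleton.elim _ _)
  | sum _ _ ih1 ih2 =>
    rintro (a | a) (b | b) (c | c) (d | d) h <;>
      simp only [InducedP4, SimpleGraph.sum_adj] at h
    all_goals first
      | exact ih1 a b c d h
      | exact ih2 a b c d h
      | tauto
  | compl _ ih => exact fun a b c d h => ih _ _ _ _ h.compl
  | iso e _ ih =>
    intro a b c d h
    refine ih (e.symm a) (e.symm b) (e.symm c) (e.symm d) ?_
    simpa [InducedP4, SimpleGraph.Iso.map_adj_iff] using h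

theorem isCograph_induce_iff {V : Type u} {G : SimpleGraph V} {X : Finset V} :
    IsCograph (G.induce (X : Set V)) ↔ X.Nonempty ∧ P4Free G X := by
  refine ⟨fun h => ⟨?_, ?_⟩, fun h => h.2.isCograph h.1⟩
  · obtain ⟨x, hx⟩ := h.nonempty
    exact ⟨x, hx⟩
  · exact fun a ha b hb c hc d hd hp =>
      h.not_inducedP4 ⟨a, ha⟩ ⟨b, hb⟩ ⟨c, hc⟩ ⟨d, hd⟩ (by simpa [InducedP4] using hp)

/-- A `P4`-free set is a maximal induced sub-cograph as soon as no single vertex can be added. -/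
theorem P4Free.isMaximalInducedCograph {V : Type u} [DecidableEq V] {G : SimpleGraph V}
    {X : Finset V} (hne : X.Nonempty) (hX : P4Free G X)
    (hmax : ∀ v, v ∉ X → ¬ P4Free G (insert v X)) : IsMaximalInducedCograph G X := by
  refine ⟨hX.isCograph hne, ?_⟩
  intro Y hY hXY v hv
  by_contra hvX
  exact hmax v hvX ((isCograph_induce_iff.1 hY).2.subset (Finset.insert_subset hv hXY))

/-! ### Twins and the neighbours of a solution -/

/-- No vertex of `X` other than `u` and `v` distinguishes `u` from `v`. -/
def Twins {V : Type*} (G : SimpleGraph V) (X : Finset V) (u v : V) : Prop :=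
  ∀ w ∈ X, w ≠ u → w ≠ v → (G.Adj w u ↔ G.Adj w v)

theorem Twins.of_compl {V : Type*} {G : SimpleGraph V} {X : Finset V} {u v : V}
    (h : Twins Gᶜ X u v) : Twins G X u v := by
  intro w hw hu hv
  simpa [hu, hv, not_iff_not] using h w hw hu hv

/-- Twins inside one side of a cut are twins. -/
theorem IsCut.exists_twins {V : Type*} {G : SimpleGraph V} {X A B : Finset V}
    (h : IsCut G X A B)
    (ih : ∀ Y ⊆ X, Y.card < X.card → 2 ≤ Y.card → ∃ u ∈ Y, ∃ v ∈ Y, u ≠ v ∧ Twins G Y u v) :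
    ∃ u ∈ X, ∃ v ∈ X, u ≠ v ∧ Twins G X u v := by
  by_cases hA : 2 ≤ A.card
  · obtain ⟨u, hu, v, hv, huv, ht⟩ := ih A h.subset_left h.card_lt.1 hA
    refine ⟨u, h.subset_left hu, v, h.subset_left hv, huv, fun w hw hwu hwv => ?_⟩
    rcases (h.2.2.1 w).1 hw with hw | hw
    · exact ht w hw hwu hwv
    · exact iff_of_false (fun e => h.2.2.2.2 u hu w hw e.symm)
        (fun e => h.2.2.2.2 v hv w hw e.symm)
  by_cases hB : 2 ≤ B.card
  · obtain ⟨u, hu, v, hv, huv, ht⟩ := ih B h.subset_right h.card_lt.2 hB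
    refine ⟨u, h.subset_right hu, v, h.subset_right hv, huv, fun w hw hwu hwv => ?_⟩
    rcases (h.2.2.1 w).1 hw with hw | hw
    · exact iff_of_false (h.2.2.2.2 w hw u hu) (h.2.2.2.2 w hw v hv)
    · exact ht w hw hwu hwv
  · have h1 := h.1.card_pos
    have h2 := h.2.1.card_pos
    obtain ⟨a, rfl⟩ := Finset.card_eq_one.1 (show A.card = 1 by omega)
    obtain ⟨b, rfl⟩ := Finset.card_eq_one.1 (show B.card = 1 by omega)
    refine ⟨a, h.subset_left (by simp), b, h.subset_right (by simp), ?_, ?_⟩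
    · simpa using h.2.2.2.1
    · intro w hw hwa hwb
      rcases (h.2.2.1 w).1 hw with hw | hw
      · exact absurd (Finset.mem_singleton.1 hw) hwa
      · exact absurd (Finset.mem_singleton.1 hw) hwb

theorem P4Free.exists_twins {V : Type*} {G : SimpleGraph V} {X : Finset V}
    (hX : P4Free G X) (hcard : 2 ≤ X.card) : ∃ u ∈ X, ∃ v ∈ X, u ≠ v ∧ Twins G X u v := by
  induction hn : X.card using Nat.strong_induction_on generalizing X with
  | _ n ih =>
    subst hn
    have ih' : ∀ Y ⊆ X, Y.card < X.card → 2 ≤ Y.card →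
        ∃ u ∈ Y, ∃ v ∈ Y, u ≠ v ∧ Twins G Y u v :=
      fun Y hYX hlt h2 => ih _ hlt (hX.subset hYX) h2 rfl
    obtain ⟨A, B, h | h⟩ := hX.exists_isCut hcard
    · exact h.exists_twins ih'
    · obtain ⟨u, hu, v, hv, huv, ht⟩ := h.exists_twins fun Y hYX hlt h2 => by
        obtain ⟨u, hu, v, hv, huv, ht⟩ := ih' Y hYX hlt h2
        exact ⟨u, hu, v, hv, huv, Twins.of_compl (by rwa [compl_compl])⟩
      exact ⟨u, hu, v, hv, huv, ht.of_compl⟩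

/-- A `P4`-free set remains `P4`-free when a twin of one of its vertices is added: an induced path
on four vertices has no twins, and the new vertex may be replaced by its twin. -/
theorem P4Free.insert_twin {V : Type*} [DecidableEq V] {G : SimpleGraph V} {X : Finset V}
    {u v : V} (hX : P4Free G X) (hu : u ∈ X) (h : Twins G X u v) : P4Free G (insert v X) := by
  by_cases hv : v ∈ X
  · rwa [Finset.insert_eq_of_mem hv]
  intro a ha b hb c hc d hd hp
  have hne : ∀ x ∈ X, x ≠ v := fun x hx => by rintro rfl; exact hv hx
  have ht : ∀ w ∈ X, w ≠ u → (G.Adj w u ↔ G.Adj w v) := fun w hw hwu => h w hw hwu (hne w hw)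
  have hs : ∀ x y, G.Adj x y ↔ G.Adj y x := fun x y => G.adj_comm x y
  have hl : ∀ x, ¬ G.Adj x x := fun x => G.loopless.irrefl x
  have h1 := hX u hu
  have h2 := fun a ha => hX a ha u hu
  have h3 := fun a ha b hb => hX a ha b hb u hu
  have h4 := fun a ha b hb c hc => hX a ha b hb c hc u hu
  simp only [InducedP4] at h1 h2 h3 h4 hp
  rcases Finset.mem_insert.1 ha with ha | ha <;> rcases Finset.mem_insert.1 hb with hb | hb <;>
    rcases Finset.mem_insert.1 hc with hc | hc <;> rcases Finset.mem_insert.1 hd with hd | hd <;>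
    first
    | exact hX a ha b hb c hc d hd hp
    | grind

/-- The set from which the neighbour of the solution `S` for the pair `u`, `v` is grown: if
`u ∈ S`, the vertex `v` is added to `S` as a twin of `u`, at the expense of the vertices that
distinguish `u` from `v`; otherwise the solution is grown from `v` alone. -/
def candidate {V : Type*} (G : SimpleGraph V) (S : Finset V) (u v : V) : Set V :=
  {w | w = v ∨ (u ∈ S ∧ w ∈ S ∧ (w = u ∨ (G.Adj w u ↔ G.Adj w v)))}

theorem P4Free.of_candidate {V : Type*} {G : SimpleGraph V} {S X : Finset V} {u v : V}
    (hS : P4Free G S) (hX : ∀ w, w ∈ X ↔ w ∈ candidate G S u v) : P4Free G X := by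
  classical
  by_cases hu : u ∈ S
  · have h1 : P4Free G (S.filter (fun w => w = u ∨ (G.Adj w u ↔ G.Adj w v))) :=
      hS.subset (Finset.filter_subset _ _)
    refine (h1.insert_twin (u := u) (v := v) (by simp [hu]) ?_).subset ?_
    · intro w hw hwu _
      exact (Finset.mem_filter.1 hw).2.resolve_left hwu
    · intro w hw
      rcases (hX w).1 hw with h | h
      · simp [h]
      · simp [h.2]
  · refine (P4Free.singleton G v).subset fun w hw => ?_
    rcases (hX w).1 hw with h | h
    · simp [h]
    · exact absurd h.1 hu

/-- A family of solutions that contains, for each member `S` and each pair `u`, `v`, a solution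
above `candidate G S u v` is cofinal: a `P4`-free set `P` that has a twin `v` of `u` lies above
a member as soon as `P \ {v}` does. -/
theorem P4Free.exists_superset {V : Type*} {G : SimpleGraph V} {F : Set (Finset V)}
    (hF : F.Nonempty) (hcl : ∀ S ∈ F, ∀ u v, ∃ S' ∈ F, candidate G S u v ⊆ S')
    {P : Finset V} (hP : P4Free G P) (hne : P.Nonempty) : ∃ S ∈ F, P ⊆ S := by
  classical
  induction hn : P.card using Nat.strong_induction_on generalizing P with
  | _ n ih =>
    by_cases hcard : 2 ≤ P.card
    · obtain ⟨u, hu, v, hv, huv, ht⟩ := hP.exists_twins hcard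
      have hu' : u ∈ P.erase v := Finset.mem_erase.2 ⟨huv, hu⟩
      obtain ⟨S, hS, hPS⟩ := ih _ (hn ▸ Finset.card_erase_lt_of_mem hv)
        (hP.subset (Finset.erase_subset v P)) ⟨u, hu'⟩ rfl
      obtain ⟨S', hS', hsub⟩ := hcl S hS u v
      refine ⟨S', hS', fun w hw => hsub ?_⟩
      by_cases hwv : w = v
      · exact Or.inl hwv
      · refine Or.inr ⟨hPS hu', hPS (Finset.mem_erase.2 ⟨hwv, hw⟩), ?_⟩
        by_cases hwu : w = u
        · exact Or.inl hwu
        · exact Or.inr (ht w hw hwu hwv)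
    · have := hne.card_pos
      obtain ⟨v, rfl⟩ := Finset.card_eq_one.1 (show P.card = 1 by omega)
      obtain ⟨S, hS⟩ := hF
      -- every candidate for a pair with second vertex `v` contains `v`
      obtain ⟨S', hS', hsub⟩ := hcl S hS v v
      exact ⟨S', hS', by simpa using hsub (Or.inl rfl)⟩

namespace RAM

/-! ### Bounds on the cost of a step and on the space -/

/-- All banks in use are among the first `16`, and all addresses in use and all contents are
smaller than `2 ^ B`. -/
def Bounded (B : ℕ) (m : Memory) : Prop :=
  ∀ a i, m a i ≠ 0 → a < 16 ∧ i < 2 ^ B ∧ m a i < 2 ^ B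

theorem Bounded.lt {B : ℕ} {m : Memory} (h : Bounded B m) (a i : ℕ) : m a i < 2 ^ B := by
  by_cases h0 : m a i = 0
  · rw [h0]
    positivity
  · exact (h a i h0).2.2

theorem Bounded.write {B : ℕ} {m : Memory} (h : Bounded B m) {a i x : ℕ} (ha : a < 16)
    (hi : i < 2 ^ B) (hx : x < 2 ^ B) : Bounded B (m.write a i x) := by
  intro b j hj
  unfold Memory.write at hj ⊢
  split_ifs at hj ⊢ with hc
  · exact ⟨hc.1 ▸ ha, hc.2 ▸ hi, hx⟩
  · exact h b j hj

theorem Bounded.spaceAtMost {B : ℕ} {m : Memory} (h : Bounded B m) :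
    SpaceAtMost m (2 ^ (3 * B + 4)) := by
  refine ⟨Finset.range 16 ×ˢ Finset.range (2 ^ B), ?_, ?_⟩
  · intro a i hai
    have := h a i hai
    simp [this.1, this.2.1]
  · have hsize : ∀ x, x < 2 ^ B → Nat.size x ≤ B := fun x hx => Nat.size_le.2 hx
    have h1 : ∀ c ∈ Finset.range 16 ×ˢ Finset.range (2 ^ B),
        1 + Nat.size c.2 + Nat.size (m c.1 c.2) ≤ 2 ^ (2 * B) := by
      intro c hc
      have h2 := hsize c.2 (by simpa using (Finset.mem_product.1 hc).2)
      have h3 := hsize _ (h.lt c.1 c.2)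
      have h4 : 2 * B < 2 ^ (2 * B) := Nat.lt_two_pow_self
      omega
    refine (Finset.sum_le_card_nsmul _ _ _ h1).trans (le_of_eq ?_)
    simp only [Finset.card_product, Finset.card_range, smul_eq_mul]
    ring

/-- The number of constants, loads and operations of an expression, each constant being charged
for its binary length. -/
def Expr.weight : Expr → ℕ
  | .const c => 1 + Nat.size c
  | .load _ e => e.weight + 1
  | .op _ e₁ e₂ => e₁.weight + e₂.weight + 1

theorem size_add_le (x y : ℕ) : Nat.size (x + y) ≤ Nat.size x + Nat.size y + 1 := by
  rw [Nat.size_le]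
  have hx := Nat.lt_size_self x
  have hy := Nat.lt_size_self y
  have h1 : 2 ^ Nat.size x ≤ 2 ^ (Nat.size x + Nat.size y) :=
    Nat.pow_le_pow_right (by norm_num) (by omega)
  have h2 : 2 ^ Nat.size y ≤ 2 ^ (Nat.size x + Nat.size y) :=
    Nat.pow_le_pow_right (by norm_num) (by omega)
  rw [pow_succ]
  omega

theorem size_mul_le (x y : ℕ) : Nat.size (x * y) ≤ Nat.size x + Nat.size y := by
  rw [Nat.size_le, pow_add]
  exact Nat.mul_lt_mul'' (Nat.lt_size_self x) (Nat.lt_size_self y)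

theorem Op.size_apply_le (o : Op) (x y : ℕ) :
    Nat.size (o.apply x y) ≤ Nat.size x + Nat.size y + 1 := by
  cases o
  · exact size_add_le x y
  · exact (Nat.size_le_size (Nat.sub_le x y)).trans (by omega)
  · exact (size_mul_le x y).trans (by omega)
  · exact (Nat.size_le_size (Nat.div_le_self x y)).trans (by omega)
  · exact (Nat.size_le_size (Nat.mod_le x y)).trans (by omega)
  all_goals
    simp only [Op.apply]
    split_ifs <;> simp

theorem Expr.size_eval_le {B : ℕ} {m : Memory} (h : Bounded B m) (e : Expr) :
    Nat.size (e.eval m) ≤ e.weight * (B + 1) := by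
  induction e with
  | const c =>
    simp only [Expr.eval, Expr.weight]
    nlinarith
  | load a e ih =>
    have := Nat.size_le.2 (h.lt a (e.eval m))
    simp only [Expr.eval, Expr.weight]
    nlinarith
  | op o e₁ e₂ ih₁ ih₂ =>
    have := o.size_apply_le (e₁.eval m) (e₂.eval m)
    simp only [Expr.eval, Expr.weight]
    nlinarith

theorem Expr.cost_le {B : ℕ} {m : Memory} (h : Bounded B m) (e : Expr) :
    e.cost m ≤ e.weight ^ 2 * (B + 2) := by
  induction e with
  | const c =>
    simp only [Expr.cost, Expr.weight]
    nlinarith [Nat.zero_le (Nat.size c * (B + 1)), Nat.zero_le (Nat.size c ^ 2 * (B + 2))]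
  | load a e ih =>
    have := Nat.size_le.2 (h.lt a (e.eval m))
    simp only [Expr.cost, Expr.weight]
    nlinarith [Nat.zero_le (e.weight * (B + 2))]
  | op o e₁ e₂ ih₁ ih₂ =>
    have h1 := (Expr.op o e₁ e₂).size_eval_le h
    simp only [Expr.cost, Expr.weight, Expr.eval] at h1 ⊢
    have h2 : (e₁.weight + e₂.weight + 1) ^ 2 * (B + 2) =
      e₁.weight ^ 2 * (B + 2) + e₂.weight ^ 2 * (B + 2) +
        (2 * (e₁.weight * e₂.weight) * (B + 2) + (2 * e₁.weight + 2 * e₂.weight) * (B + 2)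
          + (B + 2)) := by ring
    rw [h2]
    nlinarith [Nat.zero_le (e₁.weight * (B + 2)), Nat.zero_le (e₂.weight * (B + 2)),
      Nat.zero_le (e₁.weight * e₂.weight * (B + 2))]

/-- The sum of the weights of all expressions of a program. -/
def Program.weight : Program → ℕ
  | .skip => 0
  | .store _ i e => i.weight + e.weight
  | .output e => e.weight
  | .seq P Q => P.weight + Q.weight
  | .cond e P Q => e.weight + P.weight + Q.weight
  | .loop e P => e.weight + P.weight

theorem one_add_cost_le {B w : ℕ} {m : Memory} (h : Bounded B m) (e : Expr)
    (hw : e.weight ≤ w) : 1 + e.cost m ≤ 1 + w ^ 2 * (B + 2) := by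
  have h1 := e.cost_le h
  have h2 : e.weight ^ 2 * (B + 2) ≤ w ^ 2 * (B + 2) := by gcongr
  omega

/-- In a computation with bounded memories, every step has bounded cost. -/
theorem Exec.cost_le {B w : ℕ} {P : Program} {m m' : Memory} {t : List Step}
    (hP : Exec P m t m') (hw : P.weight ≤ w) (hm : Bounded B m) (ht : ∀ s ∈ t, Bounded B s.mem) :
    Bounded B m' ∧ ∀ s ∈ t, s.cost ≤ 1 + w ^ 2 * (B + 2) := by
  induction hP with
  | skip m => exact ⟨hm, by simp⟩
  | store a i e m =>
    refine ⟨ht _ (List.mem_singleton_self _), ?_⟩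
    intro s hs
    rw [List.mem_singleton] at hs
    subst hs
    simp only [Program.weight] at hw
    have h1 := i.cost_le hm
    have h2 := e.cost_le hm
    have h3 : (i.weight + e.weight) ^ 2 * (B + 2) ≤ w ^ 2 * (B + 2) := by gcongr
    have h4 : i.weight ^ 2 * (B + 2) + e.weight ^ 2 * (B + 2) ≤
      (i.weight + e.weight) ^ 2 * (B + 2) := by
      nlinarith [Nat.zero_le (i.weight * e.weight * (B + 2))]
    dsimp only
    omega
  | output e m =>
    refine ⟨hm, ?_⟩
    intro s hs
    rw [List.mem_singleton] at hs
    subst hs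
    exact one_add_cost_le hm e hw
  | seq _ _ ih₁ ih₂ =>
    simp only [Program.weight] at hw
    simp only [List.mem_append] at ht ⊢
    obtain ⟨h1, h2⟩ := ih₁ (by omega) hm fun s hs => ht s (Or.inl hs)
    obtain ⟨h3, h4⟩ := ih₂ (by omega) h1 fun s hs => ht s (Or.inr hs)
    exact ⟨h3, fun s hs => hs.elim (h2 s) (h4 s)⟩
  | cond_true _ _ ih =>
    simp only [Program.weight] at hw
    simp only [List.mem_cons, forall_eq_or_imp] at ht ⊢
    obtain ⟨h1, h2⟩ := ih (by omega) hm ht.2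
    exact ⟨h1, one_add_cost_le hm _ (by omega), h2⟩
  | cond_false _ _ ih =>
    simp only [Program.weight] at hw
    simp only [List.mem_cons, forall_eq_or_imp] at ht ⊢
    obtain ⟨h1, h2⟩ := ih (by omega) hm ht.2
    exact ⟨h1, one_add_cost_le hm _ (by omega), h2⟩
  | loop_true _ _ _ ih₁ ih₂ =>
    have hw' := hw
    simp only [Program.weight] at hw
    simp only [List.mem_cons, List.mem_append, forall_eq_or_imp] at ht ⊢
    obtain ⟨h1, h2⟩ := ih₁ (by omega) hm fun s hs => ht.2 s (Or.inl hs)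
    obtain ⟨h3, h4⟩ := ih₂ hw' h1 fun s hs => ht.2 s (Or.inr hs)
    exact ⟨h3, one_add_cost_le hm _ (by omega), fun s hs => hs.elim (h2 s) (h4 s)⟩
  | loop_false _ =>
    simp only [Program.weight] at hw
    refine ⟨hm, ?_⟩
    intro s hs
    rw [List.mem_singleton] at hs
    subst hs
    exact one_add_cost_le hm _ (by omega)

/-! ### Delays counted in steps -/

/-- The trace with the cost of every step replaced by `1`. -/
def unitCost (t : List Step) : List Step := t.map fun s => { s with cost := 1 }

theorem delaysFrom_le_of_unitCost {C D : ℕ} {t : List Step} {acc acc' : ℕ}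
    (hC : ∀ s ∈ t, s.cost ≤ C) (hacc : acc' ≤ acc * C)
    (h : ∀ d ∈ delaysFrom acc (unitCost t), d ≤ D) : ∀ d ∈ delaysFrom acc' t, d ≤ D * C := by
  induction t generalizing acc acc' with
  | nil =>
    simp only [unitCost, List.map_nil, delaysFrom, List.mem_singleton, forall_eq] at h ⊢
    exact hacc.trans (Nat.mul_le_mul_right _ h)
  | cons s t ih =>
    simp only [List.mem_cons, forall_eq_or_imp] at hC
    have h1 : acc' + s.cost ≤ (acc + 1) * C := by
      rw [add_mul, one_mul]
      exact add_le_add hacc hC.1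
    simp only [unitCost, List.map_cons, delaysFrom] at h ⊢
    split_ifs at h ⊢ with hs
    · simp only [List.mem_cons, forall_eq_or_imp] at h ⊢
      exact ⟨h1.trans (Nat.mul_le_mul_right _ h.1), ih hC.2 (Nat.zero_le _) h.2⟩
    · exact ih hC.2 h1 h

theorem delaysFrom_unitCost_append {t : List Step} (ht : outputs t = []) (acc : ℕ)
    (t' : List Step) :
    delaysFrom acc (unitCost (t ++ t')) = delaysFrom (acc + t.length) (unitCost t') := by
  induction t generalizing acc with
  | nil => rfl
  | cons s t ih =>
    have hs : s.out = none := by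
      by_contra hs
      obtain ⟨x, hx⟩ := Option.ne_none_iff_exists'.1 hs
      simp [outputs, hx] at ht
    have ht' : outputs t = [] := by simpa [outputs, List.filterMap_cons, hs] using ht
    have := ih ht' (acc + 1)
    simp only [unitCost, List.cons_append, List.map_cons, delaysFrom, hs] at this ⊢
    simp only [Option.isSome_none, Bool.false_eq_true, if_false, List.length_cons]
    rw [this]
    congr 1
    omega

/-! ### Verification of programs without output -/

/-- Whether a program contains an instruction that writes into the bank `a`. -/
def Program.writes (a : ℕ) : Program → Bool
  | .skip => false
  | .store b _ _ => a == b
  | .output _ => false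
  | .seq P Q => P.writes a || Q.writes a
  | .cond _ P Q => P.writes a || Q.writes a
  | .loop _ P => P.writes a

theorem Memory.write_of_ne {m : Memory} {a b i x : ℕ} (h : b ≠ a) : m.write a i x b = m b := by
  funext j
  simp [Memory.write, h]

theorem Exec.frame {P : Program} {m m' : Memory} {t : List Step} {a : ℕ}
    (hP : Exec P m t m') (ha : P.writes a = false) : m' a = m a := by
  induction hP with
  | skip | output | loop_false => rfl
  | store b i e m => exact Memory.write_of_ne (by simpa [Program.writes] using ha)
  | seq _ _ ih₁ ih₂ =>
    simp only [Program.writes, Bool.or_eq_false_iff] at ha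
    rw [ih₂ ha.2, ih₁ ha.1]
  | cond_true _ _ ih =>
    simp only [Program.writes, Bool.or_eq_false_iff] at ha
    exact ih ha.1
  | cond_false _ _ ih =>
    simp only [Program.writes, Bool.or_eq_false_iff] at ha
    exact ih ha.2
  | loop_true _ _ _ ih₁ ih₂ =>
    rw [ih₂ ha]
    exact ih₁ ha

/-- Started with `m`, the program `P` halts with `m'` after at most `T` steps, without output, and
all memories of the computation are bounded. -/
def Runs (B : ℕ) (P : Program) (T : ℕ) (m m' : Memory) : Prop :=
  ∃ t, Exec P m t m' ∧ outputs t = [] ∧ t.length ≤ T ∧ (∀ s ∈ t, Bounded B s.mem) ∧ Bounded B m'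

theorem Runs.frame {B T : ℕ} {P : Program} {m m' : Memory} (h : Runs B P T m m') {a : ℕ}
    (ha : P.writes a = false) : m' a = m a := by
  obtain ⟨t, ht, -⟩ := h
  exact ht.frame ha

theorem Runs.bounded {B T : ℕ} {P : Program} {m m' : Memory} (h : Runs B P T m m') :
    Bounded B m' := h.choose_spec.2.2.2.2

theorem Runs.seq {B T₁ T₂ : ℕ} {P Q : Program} {m₁ m₂ m₃ : Memory}
    (h₁ : Runs B P T₁ m₁ m₂) (h₂ : Runs B Q T₂ m₂ m₃) :
    Runs B (.seq P Q) (T₁ + T₂) m₁ m₃ := by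
  obtain ⟨t₁, e₁, o₁, l₁, b₁, -⟩ := h₁
  obtain ⟨t₂, e₂, o₂, l₂, b₂, b⟩ := h₂
  refine ⟨t₁ ++ t₂, .seq e₁ e₂, ?_, ?_, ?_, b⟩
  · simp only [outputs, List.filterMap_append] at o₁ o₂ ⊢
    simp [o₁, o₂]
  · simpa using add_le_add l₁ l₂
  · simp only [List.mem_append]
    exact fun s hs => hs.elim (b₁ s) (b₂ s)

theorem Runs.store {B : ℕ} {m : Memory} (hm : Bounded B m) (a : ℕ) (i e : Expr) (ha : a < 16)
    (hi : i.eval m < 2 ^ B) (he : e.eval m < 2 ^ B) :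
    Runs B (.store a i e) 1 m (m.write a (i.eval m) (e.eval m)) := by
  have := hm.write ha hi he
  exact ⟨_, .store a i e m, rfl, le_rfl, by simpa using this, this⟩

/-- The content of the first cell of the bank `k`, which serves as a variable. -/
def var (k : ℕ) : Expr := .load k (.const 0)

/-- Assignment to the variable `k`. -/
def assign (k : ℕ) (e : Expr) : Program := .store k (.const 0) e

theorem Runs.assign {B : ℕ} {m : Memory} (hm : Bounded B m) (k : ℕ) (e : Expr) (hk : k < 16)
    (he : e.eval m < 2 ^ B) : Runs B (assign k e) 1 m (m.write k 0 (e.eval m)) :=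
  Runs.store hm k (.const 0) e hk (show 0 < 2 ^ B by positivity) he

instance : Add Expr := ⟨.op .add⟩
instance : Sub Expr := ⟨.op .sub⟩
instance : Mul Expr := ⟨.op .mul⟩
instance : Div Expr := ⟨.op .div⟩
instance : Mod Expr := ⟨.op .mod⟩

section eval

variable (m : Memory) (e f : Expr)

@[simp] theorem eval_add : (e + f).eval m = e.eval m + f.eval m := rfl
@[simp] theorem eval_sub : (e - f).eval m = e.eval m - f.eval m := rfl
@[simp] theorem eval_mul : (e * f).eval m = e.eval m * f.eval m := rfl
@[simp] theorem eval_div : (e / f).eval m = e.eval m / f.eval m := rfl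
@[simp] theorem eval_mod : (e % f).eval m = e.eval m % f.eval m := rfl
@[simp] theorem eval_const (c : ℕ) : (Expr.const c).eval m = c := rfl
@[simp] theorem eval_load (a : ℕ) : (Expr.load a e).eval m = m a (e.eval m) := rfl
@[simp] theorem eval_var (k : ℕ) : (var k).eval m = m k 0 := rfl

end eval

/-- Repeat `P` for the values `0, 1, …, e - 1` of the variable `k`. -/
def forLoop (k : ℕ) (e : Expr) (P : Program) : Program :=
  .seq (assign k (.const 0))
    (.loop (.op .lt (var k) e) (.seq P (assign k (var k + .const 1))))

/-- Verification of a loop by an invariant `I`, where `I j` speaks about the memory before the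
round `j` and must not depend on the loop variable; banks without writes are known to be unchanged
since the start. -/
theorem Runs.forLoop {B k N T : ℕ} {e : Expr} {P : Program} {m : Memory}
    (I : ℕ → Memory → Prop) (hm : Bounded B m) (hk : k < 16) (hN : N < 2 ^ B)
    (hPk : P.writes k = false)
    (hI : ∀ j m x, I j m → I j (m.write k 0 x))
    (he : ∀ m', (∀ a, (forLoop k e P).writes a = false → m' a = m a) → e.eval m' = N)
    (h0 : I 0 m)
    (hbody : ∀ j < N, ∀ m', (∀ a, (forLoop k e P).writes a = false → m' a = m a) →
      Bounded B m' → m' k 0 = j → I j m' → ∃ m'', Runs B P T m' m'' ∧ I (j + 1) m'') :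
    ∃ m', Runs B (forLoop k e P) (2 + N * (T + 2)) m m' ∧ I N m' := by
  have hw : ∀ a, (RAM.forLoop k e P).writes a = false → a ≠ k ∧ P.writes a = false := by
    intro a ha
    simp only [RAM.forLoop, RAM.assign, Program.writes, Bool.or_eq_false_iff, beq_eq_false_iff_ne]
      at ha
    exact ⟨ha.1, ha.2.1⟩
  have key : ∀ r j, j + r = N → ∀ m', (∀ a, (RAM.forLoop k e P).writes a = false → m' a = m a) →
      Bounded B m' → m' k 0 = j → I j m' →
      ∃ m'', Runs B (.loop (.op .lt (var k) e) (.seq P (RAM.assign k (var k + .const 1))))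
        (1 + r * (T + 2)) m' m'' ∧ I N m'' := by
    intro r
    induction r with
    | zero =>
      intro j hj m' hfr hb hkj hIj
      refine ⟨m', ⟨_, .loop_false ?_, rfl, by simp, by simpa using hb, hb⟩, ?_⟩
      · simp [Expr.eval, Op.apply, he m' hfr, var, hkj, ← hj]
      · simpa [← hj] using hIj
    | succ r ih =>
      intro j hj m' hfr hb hkj hIj
      obtain ⟨m₁, hr, hI₁⟩ := hbody j (by omega) m' hfr hb hkj hIj
      have hk₁ : m₁ k 0 = j := by rw [hr.frame hPk, hkj]
      have ha := Runs.assign hr.bounded k (var k + .const 1) hk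
        (by simp only [eval_add, eval_var, eval_const, hk₁]; omega)
      have hs := hr.seq ha
      obtain ⟨m₂, hr₂, hI₂⟩ := ih (j + 1) (by omega) _ (fun a h => by
        rw [Memory.write_of_ne (hw a h).1, hr.frame (hw a h).2, hfr a h]) ha.bounded
        (by simp [Memory.write, hk₁]) (hI _ _ _ hI₁)
      obtain ⟨t₁, e₁, o₁, l₁, b₁, -⟩ := hs
      obtain ⟨t₂, e₂, o₂, l₂, b₂, b⟩ := hr₂
      refine ⟨m₂, ⟨_, .loop_true ?_ e₁ e₂, ?_, ?_, ?_, b⟩, hI₂⟩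
      · have : j < N := by omega
        simp [Expr.eval, Op.apply, he m' hfr, var, hkj, this]
      · simp only [outputs, List.filterMap_append, List.filterMap_cons] at o₁ o₂ ⊢
        simp [o₁, o₂]
      · simp only [List.length_cons, List.length_append]
        nlinarith
      · simp only [List.mem_cons, List.mem_append, forall_eq_or_imp]
        exact ⟨hb, fun s hs => hs.elim (b₁ s) (b₂ s)⟩
  have ha := Runs.assign hm k (.const 0) hk (show 0 < 2 ^ B by positivity)
  obtain ⟨m', hr, hI'⟩ := key N 0 (by omega) _
    (fun a h => Memory.write_of_ne (hw a h).1) ha.bounded (by simp [Memory.write]) (hI _ _ _ h0)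
  refine ⟨m', ?_, hI'⟩
  have := ha.seq hr
  have h2 : 2 + N * (T + 2) = 1 + (1 + N * (T + 2)) := by omega
  rw [h2]
  exact this

/-! ### Boolean expressions -/

open Classical in
/-- The expression `e` has the truth value of `p`, as `0` or `1`. -/
def Decides (m : Memory) (e : Expr) (p : Prop) : Prop := e.eval m = if p then 1 else 0

theorem Decides.and {m : Memory} {e f : Expr} {p q : Prop} (he : Decides m e p)
    (hf : Decides m f q) : Decides m (e * f) (p ∧ q) := by
  unfold Decides at *
  rw [eval_mul, he, hf]
  by_cases hp : p <;> by_cases hq : q <;> simp [hp, hq]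

theorem Decides.not {m : Memory} {e : Expr} {p : Prop} (he : Decides m e p) :
    Decides m (.const 1 - e) (¬ p) := by
  unfold Decides at *
  rw [eval_sub, he]
  by_cases hp : p <;> simp [hp]

theorem Decides.or {m : Memory} {e f : Expr} {p q : Prop} (he : Decides m e p)
    (hf : Decides m f q) : Decides m (.op .lt (.const 0) (e + f)) (p ∨ q) := by
  unfold Decides at *
  simp only [Expr.eval, Op.apply, he, hf]
  by_cases hp : p <;> by_cases hq : q <;> simp [hp, hq]

theorem decides_eq (m : Memory) (e f : Expr) :
    Decides m (.op .eq e f) (e.eval m = f.eval m) := by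
  unfold Decides
  simp [Expr.eval, Op.apply]

theorem Decides.iff {m : Memory} {e f : Expr} {p q : Prop} (he : Decides m e p)
    (hf : Decides m f q) : Decides m (.op .eq e f) (p ↔ q) := by
  unfold Decides at *
  simp only [Expr.eval, Op.apply, he, hf]
  by_cases hp : p <;> by_cases hq : q <;> simp [hp, hq]

/-! ### Codes of vertex sets -/

section setCode

variable {n : ℕ}

theorem setCode_eq_sum_map (S : Finset (Fin n)) :
    setCode S = ∑ i ∈ S.map Fin.valEmbedding, 2 ^ i := by
  simp [setCode]

theorem setCode_div_mod (S : Finset (Fin n)) (v : Fin n) [Decidable (v ∈ S)] :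
    setCode S / 2 ^ (v : ℕ) % 2 = if v ∈ S then 1 else 0 := by
  have h : (setCode S).testBit v = true ↔ v ∈ S := by
    rw [← Nat.mem_bitIndices, ← List.mem_toFinset, setCode_eq_sum_map,
      Finset.toFinset_bitIndices_sum_two_pow]
    simp [Fin.val_inj]
  rw [Nat.testBit_eq_decide_div_mod_eq, decide_eq_true_eq] at h
  split_ifs with hv
  · exact h.2 hv
  · have := mt h.1 hv
    omega

theorem setCode_injective : Function.Injective (setCode (n := n)) := by
  classical
  intro S T h
  ext v
  have h1 := setCode_div_mod S v
  rw [h, setCode_div_mod T v] at h1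
  by_cases hS : v ∈ S <;> by_cases hT : v ∈ T <;> simp_all

theorem setCode_lt (S : Finset (Fin n)) : setCode S < 2 ^ n := by
  rw [setCode_eq_sum_map]
  refine Nat.geomSum_lt le_rfl ?_
  simp

theorem setCode_insert {S : Finset (Fin n)} {v : Fin n} (hv : v ∉ S) :
    setCode (insert v S) = setCode S + 2 ^ (v : ℕ) := by
  rw [setCode, Finset.sum_insert hv, add_comm]
  rfl

end setCode

/-! ### The program -/

/-!
Banks `0` and `1` hold the input, bank `2` the powers of `2`, bank `4` the marks of the known
solutions, addressed by their codes, and bank `5` the queue. All other banks are variables: `3` is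
the solution under exploration, `6` the number of solutions taken from the queue, `7` the length of
the queue, `8` the pair `u * n + v`, `9`, `11` and `12` are counters, `10` is the set under
construction, and `13` counts induced paths. Conditional instructions are replaced by arithmetic
with truth values.
-/

/-- The binary digit number `i` of `e`, by the table of the powers of `2` in bank `2`. -/
def bit (e i : Expr) : Expr := e / .load 2 i % .const 2

/-- The entry of the adjacency matrix for the vertices `u` and `v`. -/
def adj (u v : Expr) : Expr := .load 1 (u * var 0 + v)

/-- Fill bank `2` with the powers of `2`. -/
def powers : Program :=
  .seq (.store 2 (.const 0) (.const 1))
    (forLoop 9 (var 0) (.store 2 (var 9 + .const 1) (.const 2 * .load 2 (var 9))))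

/-- The variable `12`, divided `i` times by `n`. -/
def quot : ℕ → Expr
  | 0 => var 12
  | i + 1 => quot i / var 0

/-- The digit number `i` in base `n` of the variable `12`. -/
def digit (i : ℕ) : Expr := quot i % var 0

/-- Whether the vertex `i` belongs to the set `X` in the variable `10` or is the vertex `w` in the
variable `11`. -/
def memInsert (i : Expr) : Expr :=
  .op .lt (.const 0) (bit (var 10) i + .op .eq i (var 11))

/-- Whether the four base-`n` digits of the variable `12` form an induced path inside `X ∪ {w}`. -/
def isP4 : Expr :=
  (memInsert (digit 0) * (memInsert (digit 1) * (memInsert (digit 2) * memInsert (digit 3)))) *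
    (adj (digit 0) (digit 1) * (adj (digit 1) (digit 2) * (adj (digit 2) (digit 3) *
      ((.const 1 - adj (digit 0) (digit 2)) * ((.const 1 - adj (digit 0) (digit 3)) *
        (.const 1 - adj (digit 1) (digit 3)))))))

/-- Count in the variable `13` the induced paths on four vertices inside `X ∪ {w}`. -/
def countP4 : Program :=
  .seq (assign 13 (.const 0))
    (forLoop 12 (var 0 * var 0 * var 0 * var 0) (assign 13 (var 13 + isP4)))

/-- Extend the set in the variable `10` greedily to a maximal `P4`-free set. -/
def grow : Program :=
  forLoop 11 (var 0) (.seq countP4 (assign 10 (var 10 + .load 2 (var 11) *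
    (.op .eq (var 13) (.const 0) * (.const 1 - bit (var 10) (var 11))))))

/-- The first vertex of the pair in the variable `8`. -/
def fstVertex : Expr := var 8 / var 0

/-- The second vertex of the pair in the variable `8`. -/
def sndVertex : Expr := var 8 % var 0

/-- Put into the variable `10` the set `candidate G S u v`, for the set `S` in the variable `3` and
the pair `u`, `v` in the variable `8`. The set starts as `{v}`, and `v` is not added a second time,
since its power of `2` must enter the code only once. -/
def makeCandidate : Program :=
  .seq (assign 10 (.load 2 sndVertex))
    (forLoop 9 (var 0) (assign 10 (var 10 + .load 2 (var 9) *
      ((.const 1 - .op .eq (var 9) sndVertex) * (bit (var 3) fstVertex * (bit (var 3) (var 9) *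
        .op .lt (.const 0) (.op .eq (var 9) fstVertex +
          .op .eq (adj (var 9) fstVertex) (adj (var 9) sndVertex))))))))

/-- Append the set in the variable `10` to the queue in bank `5`, whose length is the variable `7`,
unless bank `4` marks it as known already. -/
def enqueue : Program :=
  .seq (.store 5 (var 7) (var 10))
    (.seq (assign 7 (var 7 + (.const 1 - .load 4 (var 10)))) (.store 4 (var 10) (.const 1)))

/-- Take the next set from the queue, and enqueue all its neighbours. -/
def explore : Program :=
  .seq (assign 3 (.load 5 (var 6))) (.seq (assign 6 (var 6 + .const 1))
    (forLoop 8 (var 0 * var 0) (.seq makeCandidate (.seq grow enqueue))))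

/-- Fill the table of powers, and enqueue a first solution. -/
def firstSolution : Program :=
  .seq powers (.seq (assign 10 (.const 1)) (.seq grow enqueue))

/-- Output and explore the sets in the queue one after the other. -/
def search : Program :=
  .loop (.op .lt (var 6) (var 7)) (.seq (.output (.load 5 (var 6))) explore)

/-- Breadth-first search in the graph of solutions. -/
def enumerate : Program := .cond (var 0) (.seq firstSolution search) .skip

/-! ### Verification of the parts of the program -/

/-- The bound on the binary length of all numbers in the memory. The counter of the
quadruples of vertices takes values up to `n ^ 4`; set codes, powers of `2` and the length of the
queue are at most `2 ^ n`. -/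
def wordSize (n : ℕ) : ℕ := 4 * n + 4

theorem lt_two_pow_wordSize {n x : ℕ} (h : x ≤ 2 * (2 ^ n) ^ 4) : x < 2 ^ wordSize n := by
  have h1 : 2 ^ wordSize n = 16 * (2 ^ n) ^ 4 := by
    unfold wordSize
    ring
  have h2 : 0 < (2 ^ n) ^ 4 := by positivity
  omega

theorem pow_four_le (n : ℕ) : n ^ 4 ≤ (2 ^ n) ^ 4 :=
  Nat.pow_le_pow_left Nat.lt_two_pow_self.le 4

theorem sq_le (n : ℕ) : n * n ≤ (2 ^ n) ^ 4 := by
  refine le_trans ?_ (pow_four_le n)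
  rcases Nat.eq_zero_or_pos n with rfl | h
  · simp
  · calc n * n = n ^ 2 := by ring
      _ ≤ n ^ 4 := Nat.pow_le_pow_right h (by norm_num)

theorem two_pow_le (n : ℕ) : 2 ^ n ≤ (2 ^ n) ^ 4 :=
  Nat.le_self_pow (by norm_num) _

theorem setCode_lt_wordSize {n : ℕ} (S : Finset (Fin n)) : setCode S < 2 ^ wordSize n :=
  lt_two_pow_wordSize (by have := setCode_lt S; have := two_pow_le n; omega)

open Classical in
/-- The input and the table of powers are in place. -/
structure Context {n : ℕ} (G : SimpleGraph (Fin n)) (m : Memory) : Prop where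
  order : m 0 0 = n
  adj : ∀ u v : Fin n, m 1 ((u : ℕ) * n + v) = if G.Adj u v then 1 else 0
  pow : ∀ w < n, m 2 w = 2 ^ w

section

variable {n : ℕ} {G : SimpleGraph (Fin n)} {m m' : Memory}

theorem Context.congr (h : Context G m) (h0 : m' 0 = m 0) (h1 : m' 1 = m 1) (h2 : m' 2 = m 2) :
    Context G m' where
  order := by rw [h0, h.order]
  adj := by rw [h1]; exact h.adj
  pow := by rw [h2]; exact h.pow

theorem Context.decides_bit (h : Context G m) {e i : Expr} {S : Finset (Fin n)} {v : Fin n}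
    (he : e.eval m = setCode S) (hi : i.eval m = v) : Decides m (bit e i) (v ∈ S) := by
  classical
  unfold Decides bit
  simp only [eval_mod, eval_div, eval_load, eval_const, he, hi, h.pow v v.2]
  convert setCode_div_mod S v

theorem Context.decides_adj (h : Context G m) {e f : Expr} {u v : Fin n}
    (he : e.eval m = u) (hf : f.eval m = v) : Decides m (RAM.adj e f) (G.Adj u v) := by
  unfold Decides RAM.adj
  simp only [eval_load, eval_add, eval_mul, eval_var, he, hf, h.order, h.adj]

theorem decides_eq_vertex {e f : Expr} {u v : Fin n}
    (he : e.eval m = u) (hf : f.eval m = v) : Decides m (.op .eq e f) (u = v) := by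
  have := decides_eq m e f
  rwa [he, hf, Fin.val_inj] at this

theorem eval_quot (i : ℕ) : (quot i).eval m = m 12 0 / m 0 0 ^ i := by
  induction i with
  | zero => simp [quot]
  | succ i ih => simp [quot, ih, Nat.div_div_eq_div_mul, pow_succ]

/-- The digit number `i` of `k` in base `n`. -/
def digitOf (hn : 0 < n) (k i : ℕ) : Fin n := ⟨k / n ^ i % n, Nat.mod_lt _ hn⟩

theorem Context.eval_digit (h : Context G m) (hn : 0 < n) (i : ℕ) :
    (digit i).eval m = digitOf hn (m 12 0) i := by
  simp [digit, digitOf, eval_quot, h.order]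

theorem exists_digitOf (hn : 0 < n) (a b c d : Fin n) :
    ∃ k < n ^ 4, digitOf hn k 0 = a ∧ digitOf hn k 1 = b ∧ digitOf hn k 2 = c ∧
      digitOf hn k 3 = d := by
  have key : ∀ (a : Fin n) (x M : ℕ), x < M → (a : ℕ) + n * x < n * M := by
    intro a x M hx
    have h1 : n * (x + 1) ≤ n * M := Nat.mul_le_mul_left _ hx
    have h2 := a.2
    rw [mul_add] at h1
    omega
  have h3 : (d : ℕ) < n := d.2
  have h2 := key c _ _ h3
  have h1 := key b _ _ h2
  have h0 := key a _ _ h1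
  refine ⟨a + n * (b + n * (c + n * d)), ?_, ?_, ?_, ?_, ?_⟩
  · calc _ < _ := h0
      _ = n ^ 4 := by ring
  all_goals
    simp [digitOf, pow_succ, ← Nat.div_div_eq_div_mul, Nat.add_mul_div_left _ _ hn,
      Nat.div_eq_of_lt, Fin.is_lt, Nat.mod_eq_of_lt]

theorem Context.decides_isP4 (h : Context G m) (hn : 0 < n) {X : Finset (Fin n)} {w : Fin n}
    (hX : m 10 0 = setCode X) (hw : m 11 0 = w) :
    Decides m isP4
      ((digitOf hn (m 12 0) 0 ∈ insert w X ∧ digitOf hn (m 12 0) 1 ∈ insert w X ∧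
        digitOf hn (m 12 0) 2 ∈ insert w X ∧ digitOf hn (m 12 0) 3 ∈ insert w X) ∧
        InducedP4 G (digitOf hn (m 12 0) 0) (digitOf hn (m 12 0) 1) (digitOf hn (m 12 0) 2)
          (digitOf hn (m 12 0) 3)) := by
  have hd := h.eval_digit hn
  have hmem : ∀ i, Decides m (memInsert (digit i)) (digitOf hn (m 12 0) i ∈ insert w X) := by
    intro i
    rw [Finset.mem_insert, or_comm]
    exact (h.decides_bit (e := var 10) hX (hd i)).or (decides_eq_vertex (hd i) hw)
  have hadj : ∀ i j, Decides m (RAM.adj (digit i) (digit j))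
      (G.Adj (digitOf hn (m 12 0) i) (digitOf hn (m 12 0) j)) :=
    fun i j => h.decides_adj (hd i) (hd j)
  exact ((hmem 0).and ((hmem 1).and ((hmem 2).and (hmem 3)))).and
    ((hadj 0 1).and ((hadj 1 2).and ((hadj 2 3).and
      ((hadj 0 2).not.and ((hadj 0 3).not.and (hadj 1 3).not)))))

theorem runs_countP4 (h : Context G m) (hm : Bounded (wordSize n) m) {X : Finset (Fin n)}
    {w : Fin n} (hX : m 10 0 = setCode X) (hw : m 11 0 = w) :
    ∃ m', Runs (wordSize n) countP4 (3 + n ^ 4 * 3) m m' ∧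
      (m' 13 0 = 0 ↔ P4Free G (insert w X)) := by
  have hn : 0 < n := w.pos
  let Q : ℕ → Prop := fun k =>
    (digitOf hn k 0 ∈ insert w X ∧ digitOf hn k 1 ∈ insert w X ∧
      digitOf hn k 2 ∈ insert w X ∧ digitOf hn k 3 ∈ insert w X) ∧
      InducedP4 G (digitOf hn k 0) (digitOf hn k 1) (digitOf hn k 2) (digitOf hn k 3)
  have r₁ := Runs.assign hm 13 (.const 0) (by norm_num) (show 0 < 2 ^ wordSize n by positivity)
  obtain ⟨m', r₂, hI⟩ := Runs.forLoop (B := wordSize n) (k := 12) (N := n ^ 4) (T := 1)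
    (e := var 0 * var 0 * var 0 * var 0) (P := assign 13 (var 13 + isP4))
    (fun j m => m 13 0 ≤ j ∧ (m 13 0 = 0 ↔ ∀ k < j, ¬ Q k)) r₁.bounded (by norm_num)
    (lt_two_pow_wordSize (by have := pow_four_le n; omega)) rfl
    (fun j m x h => by simpa [Memory.write] using h)
    (fun m' hfr => by
      have : m' 0 0 = n := by rw [hfr 0 rfl]; exact h.order
      simp only [eval_mul, eval_var, this]
      ring)
    (by simp [Memory.write])
    (fun j hj m' hfr hb hk ⟨hle, hiff⟩ => by
      have hc : Context G m' := h.congr (hfr 0 rfl) (hfr 1 rfl) (hfr 2 rfl)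
      have hd : Decides m' isP4 (Q j) := by
        have := hc.decides_isP4 hn (X := X) (w := w) (by rw [hfr 10 rfl]; exact hX)
          (by rw [hfr 11 rfl]; exact hw)
        rwa [hk] at this
      have hle' : (var 13 + isP4).eval m' ≤ j + 1 := by
        rw [eval_add, eval_var, hd]
        split_ifs <;> omega
      refine ⟨_, Runs.assign hb 13 _ (by norm_num)
        (lt_two_pow_wordSize (by have := pow_four_le n; omega)), ?_⟩
      simp only [Memory.write, and_self, if_true]
      refine ⟨hle', ?_⟩
      rw [eval_add, eval_var, hd, Nat.forall_lt_succ_right, ← hiff]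
      by_cases hQ : Q j <;> simp [hQ])
  refine ⟨m', ?_, ?_⟩
  · have := r₁.seq r₂
    have e : 3 + n ^ 4 * 3 = 1 + (2 + n ^ 4 * (1 + 2)) := by ring
    rw [e]
    exact this
  · rw [hI.2]
    constructor
    · intro hQ a ha b hb c hc d hd hp
      obtain ⟨k, hk, rfl, rfl, rfl, rfl⟩ := exists_digitOf hn a b c d
      exact hQ k hk ⟨⟨ha, hb, hc, hd⟩, hp⟩
    · exact fun hf k _ hk => hf _ hk.1.1 _ hk.1.2.1 _ hk.1.2.2.1 _ hk.1.2.2.2 hk.2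

/-- The number of steps of `grow`. -/
def growTime (n : ℕ) : ℕ := 2 + n * (3 + n ^ 4 * 3 + 1 + 2)

theorem runs_grow (h : Context G m) (hm : Bounded (wordSize n) m) {X : Finset (Fin n)}
    (hX : m 10 0 = setCode X) (hfree : P4Free G X) :
    ∃ m' Y, Runs (wordSize n) grow (growTime n) m m' ∧ m' 10 0 = setCode Y ∧ X ⊆ Y ∧
      P4Free G Y ∧ ∀ v, v ∉ Y → ¬ P4Free G (insert v Y) := by
  obtain ⟨m', r, Y, hY, hXY, hf, hmax⟩ := Runs.forLoop (B := wordSize n) (k := 11) (N := n)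
    (T := 3 + n ^ 4 * 3 + 1) (e := var 0)
    (P := .seq countP4 (assign 10 (var 10 + .load 2 (var 11) *
    (.op .eq (var 13) (.const 0) * (.const 1 - bit (var 10) (var 11))))))
    (fun j m => ∃ Y, m 10 0 = setCode Y ∧ X ⊆ Y ∧ P4Free G Y ∧
      ∀ v : Fin n, (v : ℕ) < j → v ∉ Y → ¬ P4Free G (insert v Y)) hm (by norm_num)
    (lt_two_pow_wordSize
      (by have := two_pow_le n; have := Nat.lt_two_pow_self (n := n); omega)) rfl
    (fun j m x h => by simpa [Memory.write] using h)
    (fun m' hfr => by rw [eval_var, hfr 0 rfl, h.order])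
    ⟨X, hX, subset_rfl, hfree, by simp⟩
    (fun j hj m' hfr hb hk ⟨Y, hY, hXY, hf, hmax⟩ => by
      have hc : Context G m' := h.congr (hfr 0 rfl) (hfr 1 rfl) (hfr 2 rfl)
      let w : Fin n := ⟨j, hj⟩
      obtain ⟨m₁, r₁, hcount⟩ := runs_countP4 hc hb (w := w) hY hk
      have hc₁ : Context G m₁ := hc.congr (r₁.frame rfl) (r₁.frame rfl) (r₁.frame rfl)
      have hY₁ : m₁ 10 0 = setCode Y := by rw [r₁.frame rfl, hY]
      have hw₁ : m₁ 11 0 = w := by rw [r₁.frame rfl, hk]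
      have hd := (decides_eq m₁ (var 13) (.const 0)).and
        (hc₁.decides_bit (e := var 10) (i := var 11) hY₁ hw₁).not
      rw [eval_var, eval_const, hcount] at hd
      obtain ⟨Z, hZ, hYZ, hfZ, hwZ⟩ : ∃ Z, (var 10 + .load 2 (var 11) *
          (.op .eq (var 13) (.const 0) * (.const 1 - bit (var 10) (var 11))) : Expr).eval m₁ =
            setCode Z ∧ Y ⊆ Z ∧ P4Free G Z ∧ (w ∉ Z → ¬ P4Free G (insert w Z)) := by
        rw [eval_add, eval_mul, hd, eval_load, eval_var, eval_var, hY₁, hw₁, hc₁.pow w w.2]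
        -- a vertex that cannot be added now cannot be added later, as the set only grows
        by_cases hp : P4Free G (insert w Y)
        · by_cases hwY : w ∈ Y
          · exact ⟨Y, by simp [hwY], subset_rfl, hf, fun h => absurd hwY h⟩
          · exact ⟨insert w Y, by simp [hp, hwY, setCode_insert], Finset.subset_insert _ _, hp,
              fun h => absurd (Finset.mem_insert_self _ _) h⟩
        · exact ⟨Y, by simp [hp], subset_rfl, hf, fun _ => hp⟩
      have r₂ := Runs.assign r₁.bounded 10 _ (by norm_num) (hZ.trans_lt (setCode_lt_wordSize Z))
      refine ⟨_, r₁.seq r₂, Z, by simpa [Memory.write] using hZ, hXY.trans hYZ, hfZ, ?_⟩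
      intro v hv hvZ hfree
      rcases Nat.lt_succ_iff_lt_or_eq.1 hv with hv | hv
      · exact hmax v hv (fun h => hvZ (hYZ h)) (hfree.subset (Finset.insert_subset_insert _ hYZ))
      · obtain rfl : v = w := Fin.ext hv
        exact hwZ hvZ hfree)
  exact ⟨m', Y, r, hY, hXY, hf, fun v => hmax v v.2⟩

/-- The number of steps of `makeCandidate`. -/
def candidateTime (n : ℕ) : ℕ := 3 + n * 3

theorem runs_makeCandidate (h : Context G m) (hm : Bounded (wordSize n) m)
    {S : Finset (Fin n)} {u v : Fin n} (hS : m 3 0 = setCode S) (huv : m 8 0 = u * n + v) :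
    ∃ m' X, Runs (wordSize n) makeCandidate (candidateTime n) m m' ∧ m' 10 0 = setCode X ∧
      ∀ w, w ∈ X ↔ w ∈ candidate G S u v := by
  have hn : 0 < n := u.pos
  have hfst : ∀ m', m' 0 0 = n → m' 8 0 = u * n + v → fstVertex.eval m' = u := by
    intro m' h0 h8
    simp [fstVertex, h0, h8, Nat.add_div_of_dvd_right, hn]
  have hsnd : ∀ m', m' 0 0 = n → m' 8 0 = u * n + v → sndVertex.eval m' = v := by
    intro m' h0 h8
    simp [sndVertex, h0, h8, Nat.mod_eq_of_lt]
  have hv : (Expr.load 2 sndVertex).eval m = setCode {v} := by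
    rw [eval_load, hsnd m h.order huv, h.pow v v.2]
    simp [setCode]
  have r₁ := Runs.assign hm 10 (.load 2 sndVertex) (by norm_num)
    (hv.trans_lt (setCode_lt_wordSize _))
  obtain ⟨m', r₂, X, hX, hmem⟩ := Runs.forLoop (B := wordSize n) (k := 9) (N := n)
    (T := 1) (e := var 0)
    (P := assign 10 (var 10 + .load 2 (var 9) *
      ((.const 1 - .op .eq (var 9) sndVertex) * (bit (var 3) fstVertex * (bit (var 3) (var 9) *
        .op .lt (.const 0) (.op .eq (var 9) fstVertex +
          .op .eq (adj (var 9) fstVertex) (adj (var 9) sndVertex)))))))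
    (fun j m => ∃ X, m 10 0 = setCode X ∧ ∀ w : Fin n, w ∈ X ↔ w = v ∨
      ((w : ℕ) < j ∧ w ≠ v ∧ u ∈ S ∧ w ∈ S ∧ (w = u ∨ (G.Adj w u ↔ G.Adj w v))))
    r₁.bounded (by norm_num)
    (lt_two_pow_wordSize
      (by have := two_pow_le n; have := Nat.lt_two_pow_self (n := n); omega)) rfl
    (fun j m x h => by simpa [Memory.write] using h)
    (fun m' hfr => by rw [eval_var, hfr 0 rfl]; exact h.order)
    ⟨{v}, by simpa [Memory.write] using hv, by simp⟩
    (fun j hj m' hfr hb hk ⟨X, hX, hmem⟩ => by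
      have hc : Context G m' := h.congr (hfr 0 rfl) (hfr 1 rfl) (hfr 2 rfl)
      let w : Fin n := ⟨j, hj⟩
      have h8 : m' 8 0 = u * n + v := by rw [hfr 8 rfl]; exact huv
      have hu' := hfst m' hc.order h8
      have hv' := hsnd m' hc.order h8
      have hw' : (var 9).eval m' = w := hk
      have hS' : (var 3).eval m' = setCode S := by rw [eval_var, hfr 3 rfl]; exact hS
      have hd := (decides_eq_vertex hw' hv').not.and ((hc.decides_bit hS' hu').and
        ((hc.decides_bit hS' hw').and ((decides_eq_vertex hw' hu').or
          ((hc.decides_adj hw' hu').iff (hc.decides_adj hw' hv')))))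
      obtain ⟨Z, hZ, hmemZ⟩ : ∃ Z, (var 10 + .load 2 (var 9) *
      ((.const 1 - .op .eq (var 9) sndVertex) * (bit (var 3) fstVertex * (bit (var 3) (var 9) *
        .op .lt (.const 0) (.op .eq (var 9) fstVertex +
          .op .eq (RAM.adj (var 9) fstVertex) (RAM.adj (var 9) sndVertex))))) : Expr).eval m' =
          setCode Z ∧
          ∀ x, x ∈ Z ↔ x ∈ X ∨ (x = w ∧ w ≠ v ∧ u ∈ S ∧ w ∈ S ∧
            (w = u ∨ (G.Adj w u ↔ G.Adj w v))) := by
        rw [eval_add, eval_mul, hd, eval_load, hw', eval_var, hX, hc.pow w w.2]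
        split_ifs with hp
        · refine ⟨insert w X, ?_, ?_⟩
          · rw [setCode_insert, mul_one]
            rw [hmem, not_or]
            exact ⟨hp.1, fun h => absurd h.1 (lt_irrefl _)⟩
          · intro x
            rw [Finset.mem_insert, or_comm, and_iff_left hp]
        · exact ⟨X, by simp, fun x => by simp [hp]⟩
      have r₂ := Runs.assign hb 10 _ (by norm_num) (hZ.trans_lt (setCode_lt_wordSize Z))
      refine ⟨_, r₂, Z, by simpa [Memory.write] using hZ, ?_⟩
      intro x
      rw [hmemZ, hmem, Nat.lt_succ_iff_lt_or_eq]
      have hx : (x : ℕ) = j ↔ x = w := ⟨fun h => Fin.ext h, fun h => h ▸ rfl⟩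
      rw [hx]
      constructor
      · rintro ((h | ⟨h, h'⟩) | ⟨rfl, h'⟩)
        · exact Or.inl h
        · exact Or.inr ⟨Or.inl h, h'⟩
        · exact Or.inr ⟨Or.inr rfl, h'⟩
      · rintro (h | ⟨h | rfl, h'⟩)
        · exact Or.inl (Or.inl h)
        · exact Or.inl (Or.inr ⟨h, h'⟩)
        · exact Or.inr ⟨rfl, h'⟩)
  refine ⟨m', X, ?_, hX, ?_⟩
  · have := r₁.seq r₂
    have e : candidateTime n = 1 + (2 + n * (1 + 2)) := by unfold candidateTime; ring
    rw [e]
    exact this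
  · intro w
    rw [hmem]
    simp only [candidate, Set.mem_ofPred_eq, w.2, true_and]
    tauto

open Classical in
/-- The queue in bank `5` holds the list `L` of distinct solutions, its length is the variable `7`,
and bank `4` marks the codes of its members. -/
structure Queue (G : SimpleGraph (Fin n)) (L : List (Finset (Fin n))) (m : Memory) : Prop where
  nodup : L.Nodup
  maximal : ∀ S ∈ L, IsMaximalInducedCograph G S
  length : m 7 0 = L.length
  entry : ∀ j S, L[j]? = some S → m 5 j = setCode S
  mark : ∀ S : Finset (Fin n), m 4 (setCode S) = if S ∈ L then 1 else 0

theorem Queue.congr {L : List (Finset (Fin n))} (h : Queue G L m) (h4 : m' 4 = m 4)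
    (h5 : m' 5 = m 5) (h7 : m' 7 = m 7) : Queue G L m' where
  nodup := h.nodup
  maximal := h.maximal
  length := by rw [h7, h.length]
  entry := by rw [h5]; exact h.entry
  mark := by rw [h4]; exact h.mark

theorem Queue.length_le {L : List (Finset (Fin n))} (h : Queue G L m) : L.length ≤ 2 ^ n := by
  simpa using h.nodup.length_le_card

theorem Queue.runs_enqueue {L : List (Finset (Fin n))} (h : Queue G L m)
    (hm : Bounded (wordSize n) m) {X : Finset (Fin n)} (hX : m 10 0 = setCode X)
    (hmax : IsMaximalInducedCograph G X) :
    ∃ m' L', Runs (wordSize n) enqueue 3 m m' ∧ Queue G L' m' ∧ L <+: L' ∧ X ∈ L' := by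
  classical
  have hlen := h.length_le
  have hpow := two_pow_le n
  have hcode := setCode_lt X
  have r₁ := Runs.store hm 5 (var 7) (var 10) (by norm_num)
    (by rw [eval_var, h.length]; exact lt_two_pow_wordSize (by omega))
    (by rw [eval_var, hX]; exact lt_two_pow_wordSize (by omega))
  simp only [eval_var, h.length, hX] at r₁
  have e₂ : (var 7 + (.const 1 - .load 4 (var 10)) : Expr).eval
      (m.write 5 L.length (setCode X)) = L.length + if X ∈ L then 0 else 1 := by
    simp only [eval_add, eval_sub, eval_var, eval_load, eval_const]
    rw [Memory.write_of_ne (by norm_num), Memory.write_of_ne (by norm_num),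
      Memory.write_of_ne (by norm_num), h.length, hX, h.mark]
    split_ifs <;> rfl
  have r₂ := Runs.assign r₁.bounded 7 (var 7 + (.const 1 - .load 4 (var 10))) (by norm_num)
    (by rw [e₂]; exact lt_two_pow_wordSize (by split_ifs <;> omega))
  rw [e₂] at r₂
  have e₃ : (var 10).eval ((m.write 5 L.length (setCode X)).write 7 0
      (L.length + if X ∈ L then 0 else 1)) = setCode X := by
    rw [eval_var, Memory.write_of_ne (by norm_num), Memory.write_of_ne (by norm_num), hX]
  have r₃ := Runs.store r₂.bounded 4 (var 10) (.const 1) (by norm_num)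
    (by rw [e₃]; exact lt_two_pow_wordSize (by omega))
    (by rw [eval_const]; exact lt_two_pow_wordSize (by omega))
  rw [e₃, eval_const] at r₃
  have r := r₁.seq (r₂.seq r₃)
  refine ⟨_, if X ∈ L then L else L ++ [X], r, ?_, ?_, ?_⟩
  · constructor
    · split_ifs with hXL
      · exact h.nodup
      · exact h.nodup.append (List.nodup_singleton X) (by simpa using hXL)
    · intro S hS
      split_ifs at hS with hXL
      · exact h.maximal S hS
      · rcases List.mem_append.1 hS with hS | hS
        · exact h.maximal S hS
        · exact (List.mem_singleton.1 hS) ▸ hmax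
    · rw [Memory.write_of_ne (by norm_num)]
      simp only [Memory.write, and_self, if_true]
      split_ifs <;> simp
    · intro j S hj
      rw [Memory.write_of_ne (by norm_num), Memory.write_of_ne (by norm_num)]
      simp only [Memory.write, true_and]
      have hj' : L[j]? = some S ∨ (j = L.length ∧ S = X) := by
        split_ifs at hj with hXL
        · exact Or.inl hj
        · rcases lt_or_ge j L.length with hlt | hge
          · rw [List.getElem?_append_left hlt] at hj
            exact Or.inl hj
          · rw [List.getElem?_append_right hge, List.getElem?_singleton] at hj
            split_ifs at hj with h0
            exact Or.inr ⟨by omega, (Option.some.inj hj).symm⟩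
      rcases hj' with hj' | ⟨rfl, rfl⟩
      · obtain ⟨hlt, -⟩ := List.getElem?_eq_some_iff.1 hj'
        rw [if_neg hlt.ne]
        exact h.entry j S hj'
      · rw [if_pos rfl]
    · intro S
      by_cases hSX : S = X
      · subst hSX
        by_cases hSL : S ∈ L <;> simp [Memory.write, hSL]
      · have hne : setCode S ≠ setCode X := fun e => hSX (setCode_injective e)
        simp only [Memory.write, true_and, hne, if_false]
        have hm4 := h.mark S
        by_cases hXL : X ∈ L <;> simpa [hXL, hSX] using hm4
  · split_ifs
    · exact List.prefix_rfl
    · exact List.prefix_append _ _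
  · split_ifs with hXL
    · exact hXL
    · simp

theorem runs_grow_enqueue (h : Context G m) (hm : Bounded (wordSize n) m)
    {L : List (Finset (Fin n))} (hL : Queue G L m) {X : Finset (Fin n)}
    (hX : m 10 0 = setCode X) (hne : X.Nonempty) (hfree : P4Free G X) :
    ∃ m' L', Runs (wordSize n) (.seq grow enqueue) (growTime n + 3) m m' ∧ Queue G L' m' ∧
      L <+: L' ∧ ∃ S ∈ L', X ⊆ S := by
  obtain ⟨m₁, Y, r₁, hY, hXY, hf, hmax⟩ := runs_grow h hm hX hfree
  have hL₁ : Queue G L m₁ := hL.congr (r₁.frame rfl) (r₁.frame rfl) (r₁.frame rfl)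
  obtain ⟨m₂, L', r₂, hL', hLL', hYL'⟩ := hL₁.runs_enqueue r₁.bounded hY
    (hf.isMaximalInducedCograph (hne.mono hXY) hmax)
  exact ⟨m₂, L', r₁.seq r₂, hL', hLL', Y, hYL', hXY⟩

/-- The number of steps of `explore`. -/
def exploreTime (n : ℕ) : ℕ :=
  4 + n * n * (candidateTime n + (growTime n + 3) + 2)

theorem runs_explore (h : Context G m) (hm : Bounded (wordSize n) m)
    {L : List (Finset (Fin n))} (hL : Queue G L m) {j : ℕ} {S : Finset (Fin n)}
    (hj : m 6 0 = j) (hS : L[j]? = some S) :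
    ∃ m' L', Runs (wordSize n) explore (exploreTime n) m m' ∧ Queue G L' m' ∧ L <+: L' ∧
      m' 6 0 = j + 1 ∧ ∀ u v, ∃ S' ∈ L', candidate G S u v ⊆ S' := by
  have hlen := hL.length_le
  have hpow := two_pow_le n
  obtain ⟨hjL, -⟩ := List.getElem?_eq_some_iff.1 hS
  have e₁ : (Expr.load 5 (var 6)).eval m = setCode S := by
    rw [eval_load, eval_var, hj, hL.entry j S hS]
  have r₁ := Runs.assign hm 3 (.load 5 (var 6)) (by norm_num)
    (e₁.trans_lt (setCode_lt_wordSize S))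
  rw [e₁] at r₁
  have e₂ : (var 6 + .const 1 : Expr).eval (m.write 3 0 (setCode S)) = j + 1 := by
    rw [eval_add, eval_var, Memory.write_of_ne (by norm_num), hj, eval_const]
  have r₂ := Runs.assign r₁.bounded 6 (var 6 + .const 1) (by norm_num)
    (by rw [e₂]; exact lt_two_pow_wordSize (by omega))
  rw [e₂] at r₂
  set m₂ := (m.write 3 0 (setCode S)).write 6 0 (j + 1) with hm₂
  have f₂ : ∀ a, a ≠ 3 → a ≠ 6 → m₂ a = m a := fun a h3 h6 => by
    rw [hm₂, Memory.write_of_ne h6, Memory.write_of_ne h3]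
  have hS₂ : m₂ 3 0 = setCode S := by simp [hm₂, Memory.write]
  have hj₂ : m₂ 6 0 = j + 1 := by simp [hm₂, Memory.write]
  have hc₂ : Context G m₂ := h.congr (f₂ 0 (by norm_num) (by norm_num))
    (f₂ 1 (by norm_num) (by norm_num)) (f₂ 2 (by norm_num) (by norm_num))
  have hL₂ : Queue G L m₂ := hL.congr (f₂ 4 (by norm_num) (by norm_num))
    (f₂ 5 (by norm_num) (by norm_num)) (f₂ 7 (by norm_num) (by norm_num))
  have hfree : P4Free G S :=
    (isCograph_induce_iff.1 (hL.maximal S (List.mem_of_getElem? hS)).prop).2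
  obtain ⟨m', r₃, L', hL', hLL', hcov⟩ := Runs.forLoop (B := wordSize n) (k := 8) (N := n * n)
    (T := candidateTime n + (growTime n + 3)) (e := var 0 * var 0)
    (P := .seq makeCandidate (.seq grow enqueue))
    (fun i m => ∃ L', Queue G L' m ∧ L <+: L' ∧ ∀ u v : Fin n, (u : ℕ) * n + v < i →
      ∃ S' ∈ L', candidate G S u v ⊆ S') r₂.bounded (by norm_num)
    (lt_two_pow_wordSize (by have := sq_le n; omega)) rfl
    (fun i m x ⟨L', h1, h2⟩ => ⟨L', h1.congr rfl rfl rfl, h2⟩)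
    (fun m' hfr => by rw [eval_mul, eval_var, hfr 0 rfl, hc₂.order])
    ⟨L, hL₂, List.prefix_rfl, by simp⟩
    (fun i hi m' hfr hb hk ⟨L', hL', hLL', hcov⟩ => by
      have hc : Context G m' := hc₂.congr (hfr 0 rfl) (hfr 1 rfl) (hfr 2 rfl)
      have hn : 0 < n := by
        rcases Nat.eq_zero_or_pos n with h0 | h0
        · simp [h0] at hi
        · exact h0
      let u : Fin n := ⟨i / n, Nat.div_lt_of_lt_mul hi⟩
      let v : Fin n := ⟨i % n, Nat.mod_lt _ hn⟩
      have huv : i = (u : ℕ) * n + v := by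
        simp only [u, v]
        rw [mul_comm]
        exact (Nat.div_add_mod i n).symm
      obtain ⟨m₃, X, r₃, hX, hmem⟩ := runs_makeCandidate hc hb (S := S) (u := u) (v := v)
        (by rw [hfr 3 rfl, hS₂]) (hk.trans huv)
      have hc₃ : Context G m₃ := hc.congr (r₃.frame rfl) (r₃.frame rfl) (r₃.frame rfl)
      have hL₃ : Queue G L' m₃ := hL'.congr (r₃.frame rfl) (r₃.frame rfl) (r₃.frame rfl)
      obtain ⟨m₄, L₄, r₄, hL₄, hpre, S', hS', hXS'⟩ := runs_grow_enqueue hc₃ r₃.bounded hL₃ hX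
        ⟨v, (hmem v).2 (Or.inl rfl)⟩ (hfree.of_candidate hmem)
      refine ⟨m₄, r₃.seq r₄, L₄, hL₄, hLL'.trans hpre, ?_⟩
      intro a b hab
      rcases Nat.lt_succ_iff_lt_or_eq.1 hab with hab | hab
      · obtain ⟨S'', hS'', hsub⟩ := hcov a b hab
        exact ⟨S'', hpre.subset hS'', hsub⟩
      · have ha : a = u := Fin.ext (by
          simp [u, ← hab, Nat.add_div_of_dvd_right, hn])
        have hb : b = v := Fin.ext (by
          simp [v, ← hab, Nat.mod_eq_of_lt])
        exact ⟨S', hS', fun w hw => hXS' ((hmem w).2 (by rwa [← ha, ← hb]))⟩)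
  refine ⟨m', L', ?_, hL', hLL', ?_, fun u v => hcov u v ?_⟩
  · have := r₁.seq (r₂.seq r₃)
    have e : exploreTime n =
        1 + (1 + (2 + n * n * (candidateTime n + (growTime n + 3) + 2))) := by
      unfold exploreTime
      ring
    rw [e]
    exact this
  · rw [r₃.frame rfl, hj₂]
  · have h1 := u.2
    have h2 := v.2
    have h3 : ((u : ℕ) + 1) * n ≤ n * n := Nat.mul_le_mul_right _ h1
    rw [add_mul] at h3
    omega

end

/-! ### Initialization -/

section

variable {n : ℕ} {G : SimpleGraph (Fin n)} {m : Memory}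

theorem graphInput_order : graphInput G 0 0 = n := by simp [graphInput]

open Classical in
theorem graphInput_adj (u v : Fin n) :
    graphInput G 1 ((u : ℕ) * n + v) = if G.Adj u v then 1 else 0 := by
  have hn : 0 < n := u.pos
  have h : (∃ u' v' : Fin n, (u : ℕ) * n + v = u' * n + v' ∧ G.Adj u' v') ↔ G.Adj u v := by
    refine ⟨?_, fun h => ⟨u, v, rfl, h⟩⟩
    rintro ⟨u', v', he, hadj⟩
    have h1 : ((u : ℕ) * n + v) / n = (u' * n + v') / n := by rw [he]
    have h2 : ((u : ℕ) * n + v) % n = (u' * n + v') % n := by rw [he]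
    have h1' : u = u' :=
      Fin.ext (by simpa [Nat.add_div_of_dvd_right, hn, Nat.div_eq_of_lt] using h1)
    have h2' : v = v' := Fin.ext (by simpa [Nat.mod_eq_of_lt] using h2)
    rwa [h1', h2']
  simp [graphInput, h]

theorem graphInput_eq_zero {a : ℕ} (ha : 2 ≤ a) (i : ℕ) : graphInput G a i = 0 := by
  simp [graphInput, show a ≠ 0 by omega, show a ≠ 1 by omega]

theorem bounded_graphInput : Bounded (wordSize n) (graphInput G) := by
  have h2 := two_pow_le n
  have h3 := Nat.lt_two_pow_self (n := n)
  intro a i hai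
  unfold graphInput at hai ⊢
  split_ifs at hai ⊢ with h h'
  · exact ⟨by omega, by rw [h.2]; positivity, lt_two_pow_wordSize (by omega)⟩
  · obtain ⟨rfl, u, v, rfl, -⟩ := h'
    refine ⟨by norm_num, lt_two_pow_wordSize ?_, lt_two_pow_wordSize (by omega)⟩
    have h1 : ((u : ℕ) + 1) * n ≤ n * n := Nat.mul_le_mul_right _ u.2
    have := v.2
    have := sq_le n
    rw [add_mul] at h1
    omega
  · exact absurd rfl hai

theorem runs_powers : ∃ m', Runs (wordSize n) powers (3 + n * 3) (graphInput G) m' ∧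
    Context G m' := by
  have h2 := two_pow_le n
  have h3 := Nat.lt_two_pow_self (n := n)
  have r₁ := Runs.store (bounded_graphInput (G := G)) 2 (.const 0) (.const 1) (by norm_num)
    (by rw [eval_const]; positivity) (by rw [eval_const]; exact lt_two_pow_wordSize (by omega))
  simp only [eval_const] at r₁
  obtain ⟨m', r₂, hI⟩ := Runs.forLoop (B := wordSize n) (k := 9) (N := n) (T := 1) (e := var 0)
    (P := .store 2 (var 9 + .const 1) (.const 2 * .load 2 (var 9)))
    (fun j m => ∀ w ≤ j, m 2 w = 2 ^ w) r₁.bounded (by norm_num)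
    (lt_two_pow_wordSize (by omega)) rfl
    (fun j m x h => by simpa [Memory.write] using h)
    (fun m' hfr => by rw [eval_var, hfr 0 rfl]; exact graphInput_order (G := G))
    (by simp [Memory.write])
    (fun j hj m' _ hb hk hI => by
      have hpow : 2 ^ (j + 1) ≤ 2 ^ n := Nat.pow_le_pow_right (by norm_num) hj
      have ei : (var 9 + .const 1 : Expr).eval m' = j + 1 := by
        rw [eval_add, eval_var, eval_const, hk]
      have ee : (.const 2 * .load 2 (var 9) : Expr).eval m' = 2 ^ (j + 1) := by
        rw [eval_mul, eval_const, eval_load, eval_var, hk, hI j le_rfl, pow_succ, mul_comm]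
      refine ⟨_, Runs.store hb 2 _ _ (by norm_num)
        (by rw [ei]; exact lt_two_pow_wordSize (by omega))
        (by rw [ee]; exact lt_two_pow_wordSize (by omega)), ?_⟩
      rw [ei, ee]
      intro w hw
      rcases Nat.le_succ_iff.1 hw with hw | rfl
      · simpa [Memory.write, show w ≠ j + 1 by omega] using hI w hw
      · simp [Memory.write])
  refine ⟨m', ?_, ?_, ?_, fun w hw => hI w hw.le⟩
  · have := r₁.seq r₂
    have e : 3 + n * 3 = 1 + (2 + n * (1 + 2)) := by ring
    rw [e]
    exact this
  · rw [r₂.frame rfl]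
    exact graphInput_order (G := G)
  · intro u v
    rw [r₂.frame rfl]
    exact graphInput_adj u v

/-- The number of steps of `firstSolution`. -/
def firstSolutionTime (n : ℕ) : ℕ := 3 + n * 3 + (1 + (growTime n + 3))

theorem runs_firstSolution (hn : 0 < n) :
    ∃ m' L, Runs (wordSize n) firstSolution (firstSolutionTime n) (graphInput G) m' ∧
      Context G m' ∧ Queue G L m' ∧ L ≠ [] ∧ m' 6 0 = 0 := by
  obtain ⟨m₁, r₁, hc₁⟩ := runs_powers (G := G)
  have r₂ := Runs.assign r₁.bounded 10 (.const 1) (by norm_num)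
    (by
      rw [eval_const]
      exact lt_two_pow_wordSize
        (by have := two_pow_le n; have := Nat.one_le_two_pow (n := n); omega))
  set m₂ := m₁.write 10 0 ((Expr.const 1).eval m₁) with hm₂
  have f₂ : ∀ a, a ≠ 10 → m₂ a = m₁ a := fun a ha => Memory.write_of_ne ha
  have hc₂ : Context G m₂ := hc₁.congr (f₂ 0 (by norm_num)) (f₂ 1 (by norm_num))
    (f₂ 2 (by norm_num))
  have hz : ∀ a, powers.writes a = false → 2 ≤ a → a ≠ 10 → ∀ i, m₂ a i = 0 := by
    intro a ha ha2 ha10 i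
    rw [f₂ a ha10, r₁.frame ha, graphInput_eq_zero ha2]
  have hL₂ : Queue G [] m₂ :=
    { nodup := List.nodup_nil
      maximal := by simp
      length := hz 7 rfl (by norm_num) (by norm_num) 0
      entry := by simp
      mark := fun S => by rw [hz 4 rfl (by norm_num) (by norm_num)]; simp }
  let v : Fin n := ⟨0, hn⟩
  obtain ⟨m₃, L, r₃, hL, -, S, hS, -⟩ := runs_grow_enqueue hc₂ r₂.bounded hL₂ (X := {v})
    (by simp [hm₂, Memory.write, setCode, v]) (Finset.singleton_nonempty v)
    (P4Free.singleton G v)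
  refine ⟨m₃, L, r₁.seq (r₂.seq r₃),
    hc₂.congr (r₃.frame rfl) (r₃.frame rfl) (r₃.frame rfl), hL, List.ne_nil_of_mem hS, ?_⟩
  rw [r₃.frame rfl]
  exact hz 6 rfl (by norm_num) (by norm_num) 0

/-! ### The search -/

/-- The neighbours of the solution `S` are covered by the list `L`. -/
def Explored (G : SimpleGraph (Fin n)) (L : List (Finset (Fin n))) (S : Finset (Fin n)) : Prop :=
  ∀ u v, ∃ S' ∈ L, candidate G S u v ⊆ S'

/-- If all members of a nonempty queue are explored, it holds all solutions. -/
theorem Queue.mem_iff {L : List (Finset (Fin n))} (h : Queue G L m) (hne : L ≠ [])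
    (hex : ∀ S ∈ L, Explored G L S) (S : Finset (Fin n)) :
    S ∈ L ↔ IsMaximalInducedCograph G S := by
  refine ⟨h.maximal S, fun hS => ?_⟩
  obtain ⟨h1, h2⟩ := isCograph_induce_iff.1 hS.prop
  obtain ⟨S', hS', hsub⟩ := h2.exists_superset (F := {S | S ∈ L})
    (List.exists_mem_of_ne_nil L hne) hex h1
  rwa [hsub.antisymm (hS.2 (h.maximal S' hS').prop hsub)]

/-- The search from the state in which the first `j` sets of the queue are explored. The delay is
counted in steps, and `acc` is the number of steps since the last output. -/
theorem exec_search {D : ℕ} (hD : exploreTime n ≤ D) (r : ℕ) :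
    ∀ (j : ℕ) (L : List (Finset (Fin n))) (m : Memory), j + r = 2 ^ n → Context G m →
      Bounded (wordSize n) m → Queue G L m → m 6 0 = j → j ≤ L.length →
      (∀ S ∈ L.take j, Explored G L S) →
      ∃ t m' L', Exec search m t m' ∧ (∀ s ∈ t, Bounded (wordSize n) s.mem) ∧
        Queue G L' m' ∧ L <+: L' ∧ (∀ S ∈ L', Explored G L' S) ∧
        outputs t = (L'.drop j).map setCode ∧
        ∀ acc ≤ D, ∀ d ∈ delaysFrom acc (unitCost t), d ≤ D + 2 := by
  -- the computation ends when all sets in the queue are explored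
  have halt : ∀ (j : ℕ) (L : List (Finset (Fin n))) (m : Memory),
      Bounded (wordSize n) m → Queue G L m → m 6 0 = j → j = L.length →
      (∀ S ∈ L.take j, Explored G L S) →
      ∃ t m' L', Exec search m t m' ∧ (∀ s ∈ t, Bounded (wordSize n) s.mem) ∧
        Queue G L' m' ∧ L <+: L' ∧ (∀ S ∈ L', Explored G L' S) ∧
        outputs t = (L'.drop j).map setCode ∧
        ∀ acc ≤ D, ∀ d ∈ delaysFrom acc (unitCost t), d ≤ D + 2 := by
    intro j L m hb hL hj hjL hex
    refine ⟨_, m, L, .loop_false ?_, by simpa using hb, hL, List.prefix_rfl, ?_, ?_, ?_⟩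
    · simp [Expr.eval, Op.apply, var, hj, hL.length, hjL]
    · simpa [hjL] using hex
    · simp [outputs, hjL]
    · intro acc hacc d hd
      simp only [unitCost, List.map_cons, List.map_nil, delaysFrom, Option.isSome_none,
        Bool.false_eq_true, if_false, List.mem_singleton] at hd
      omega
  induction r with
  | zero =>
    intro j L m hjr _ hb hL hj hjL hex
    -- the queue never holds more than `2 ^ n` sets, so all of them are explored
    have := hL.length_le
    exact halt j L m hb hL hj (by omega) hex
  | succ r ih =>
    intro j L m hjr hc hb hL hj hjL hex
    rcases hjL.eq_or_lt with hjL | hjL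
    · exact halt j L m hb hL hj hjL hex
    have hS : L[j]? = some L[j] := List.getElem?_eq_getElem hjL
    obtain ⟨m₁, L₁, ⟨t₁, e₁, o₁, l₁, b₁, hb₁⟩, hL₁, hpre, hj₁, hexp⟩ :=
      runs_explore hc hb hL hj hS
    obtain ⟨M, rfl⟩ := hpre
    obtain ⟨t₂, m₂, L₂, e₂, b₂, hL₂, hpre₂, hex₂, o₂, hd₂⟩ := ih (j + 1) (L ++ M) m₁ (by omega)
      (hc.congr (e₁.frame rfl) (e₁.frame rfl) (e₁.frame rfl)) hb₁ hL₁ hj₁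
      (by rw [List.length_append]; omega) (by
        intro S hS
        rw [List.take_append_of_le_length (by omega), List.take_succ_eq_append_getElem hjL,
          List.mem_append, List.mem_singleton] at hS
        rcases hS with hS | rfl
        · intro u v
          obtain ⟨S', hS', hsub⟩ := hex S hS u v
          exact ⟨S', List.mem_append_left M hS', hsub⟩
        · exact hexp)
    obtain ⟨M₂, rfl⟩ := hpre₂
    have hout := (Exec.output (.load 5 (var 6)) m)
    refine ⟨_, m₂, _, .loop_true ?_ (.seq hout e₁) e₂, ?_, hL₂,
      ⟨M ++ M₂, (List.append_assoc _ _ _).symm⟩, hex₂, ?_, ?_⟩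
    · simp [Expr.eval, Op.apply, var, hj, hL.length, hjL]
    · simp only [List.mem_cons, List.mem_append, List.not_mem_nil, or_false]
      rintro s (rfl | (rfl | hs) | hs)
      · exact hb
      · exact hb
      · exact b₁ s hs
      · exact b₂ s hs
    · have hdrop : (L ++ M ++ M₂).drop j = L[j] :: (L ++ M ++ M₂).drop (j + 1) := by
        rw [List.drop_eq_getElem_cons (by simp only [List.length_append]; omega)]
        rw [List.getElem_append_left (by rw [List.length_append]; omega),
          List.getElem_append_left hjL]
      have he : (Expr.load 5 (var 6)).eval m = setCode L[j] := by
        rw [eval_load, eval_var, hj, hL.entry j _ hS]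
      rw [hdrop, List.map_cons, ← o₂, ← he]
      simp only [outputs] at o₁
      simp [outputs, o₁]
    · intro acc hacc d hd
      have hu := delaysFrom_unitCost_append o₁ 0 t₂
      simp only [List.cons_append, List.nil_append] at hd
      simp only [unitCost, List.map_cons, delaysFrom, Option.isSome_none, Option.isSome_some,
        Bool.false_eq_true, if_false, if_true, List.mem_cons] at hd
      rcases hd with rfl | hd
      · omega
      · exact hd₂ (0 + t₁.length) (by omega) d (by rw [← hu]; exact hd)

/-- A bound, in steps, for the time before the first output and the time of one exploration. -/
def stepBound (n : ℕ) : ℕ := 1 + firstSolutionTime n + exploreTime n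

theorem exec_enumerate (G : SimpleGraph (Fin n)) :
    ∃ t m', Exec enumerate (graphInput G) t m' ∧ (∀ s ∈ t, Bounded (wordSize n) s.mem) ∧
      (∃ L : List (Finset (Fin n)), L.Nodup ∧ (∀ S, S ∈ L ↔ IsMaximalInducedCograph G S) ∧
        outputs t = L.map setCode) ∧
      ∀ d ∈ delaysFrom 0 (unitCost t), d ≤ stepBound n + 2 := by
  rcases Nat.eq_zero_or_pos n with rfl | hn
  · refine ⟨_, _, .cond_false (by rw [eval_var, graphInput_order]) (.skip _),
      by simpa using bounded_graphInput, ⟨[], List.nodup_nil, fun S => ?_, rfl⟩, ?_⟩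
    · refine iff_of_false (List.not_mem_nil) fun h => ?_
      obtain ⟨x, -⟩ := (isCograph_induce_iff.1 h.prop).1
      exact x.elim0
    · simp [unitCost, delaysFrom]
  · obtain ⟨m₁, L₁, ⟨t₁, e₁, o₁, l₁, b₁, hb₁⟩, hc₁, hL₁, hne, hj₁⟩ :=
      runs_firstSolution (G := G) hn
    obtain ⟨t₂, m₂, L₂, e₂, b₂, hL₂, hpre, hex, o₂, hd⟩ := exec_search (G := G)
      (D := stepBound n) (by unfold stepBound; omega) (2 ^ n) 0 L₁ m₁ (by omega) hc₁ hb₁ hL₁ hj₁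
      (Nat.zero_le _) (by simp)
    refine ⟨_, m₂, .cond_true (by rw [eval_var, graphInput_order]; omega) (.seq e₁ e₂), ?_,
      ⟨L₂, hL₂.nodup, hL₂.mem_iff ?_ hex, ?_⟩, ?_⟩
    · simp only [List.mem_cons, List.mem_append]
      rintro s (rfl | hs | hs)
      · exact bounded_graphInput
      · exact b₁ s hs
      · exact b₂ s hs
    · rintro rfl
      exact hne (List.prefix_nil.1 hpre)
    · simp only [outputs] at o₁ o₂
      simpa [outputs, o₁] using o₂
    · have hu := delaysFrom_unitCost_append o₁ 1 t₂
      intro d hd'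
      refine hd (1 + t₁.length) (by unfold stepBound; omega) d ?_
      rw [← hu]
      simpa [unitCost, delaysFrom] using hd'

end

/-- The polynomial that takes the values of `stepBound`. -/
theorem exists_polynomial_stepBound : ∃ p : Polynomial ℕ, ∀ n, p.eval n = stepBound n := by
  refine ⟨1 + (3 + .X * 3 + (1 + ((2 + .X * (3 + .X ^ 4 * 3 + 1 + 2)) + 3))) +
    (4 + .X * .X * ((3 + .X * 3) + ((2 + .X * (3 + .X ^ 4 * 3 + 1 + 2)) + 3) + 2)), fun n => ?_⟩
  simp [stepBound, firstSolutionTime, exploreTime, candidateTime, growTime]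

end RAM

theorem mainTheorem4 :
    ∃ (P : RAM.Program) (p q : Polynomial ℕ), ∀ (n : ℕ) (G : SimpleGraph (Fin n)),
      ∃ (t : List RAM.Step) (m : RAM.Memory),
        RAM.Exec P (RAM.graphInput G) t m ∧
        (∃ L : List (Finset (Fin n)), L.Nodup ∧
          (∀ S : Finset (Fin n), S ∈ L ↔ IsMaximalInducedCograph G S) ∧
          RAM.outputs t = L.map RAM.setCode) ∧
        (∀ d ∈ RAM.delays t, d ≤ p.eval n) ∧
        (∀ s ∈ t, RAM.SpaceAtMost s.mem (2 ^ q.eval n)) := by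
  obtain ⟨p, hp⟩ := RAM.exists_polynomial_stepBound
  refine ⟨RAM.enumerate,
    (p + 2) * (1 + Polynomial.C (RAM.enumerate.weight ^ 2) * ((4 * .X + 4) + 2)),
    3 * (4 * .X + 4) + 4, fun n G => ?_⟩
  obtain ⟨t, m, he, hb, hL, hd⟩ := RAM.exec_enumerate G
  refine ⟨t, m, he, hL, ?_, ?_⟩
  · have hcost := (he.cost_le le_rfl RAM.bounded_graphInput hb).2
    have := RAM.delaysFrom_le_of_unitCost hcost (Nat.zero_le (0 * _)) hd
    simpa [RAM.delays, hp, RAM.wordSize] using this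
  · intro s hs
    have := (hb s hs).spaceAtMost
    simpa [RAM.wordSize] using this
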